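/- Let $n\ge 2$ and $s\ge 0$ be integers, $\omega\in\mathbb C^n$, $R_\omega>0$, and let $B(\omega,R_\omega)$ be the open ball of $\mathbb C^n$ for the Hermitian norm. Let $\mathbf A^2(\omega,R_\omega)$ be the space of analytic square integrable functions on $B(\omega,R_\omega)$ with the inner product $$\langle f,g\rangle=\frac{n!}{\pi^nR_\omega^{2n}}\int_{B(\omega,R_\omega)}f(z)\overline{g(z)}\,dz ,$$ and equip $\mathbf A^2(\omega,R_\omega)^s$ with $\langle f,g\rangle=\sum_i\langle f_i,g_i\rangle$ and $\mathbf A^2(\omega,R_\omega)^s\times\mathbb C^n$ with the product Hermitian structure, $\|(f,x)\|^2=\|f\|^2+\|x\|^2$. Let $\mathrm{eval}(f,x)=f(x)\in\mathbb C^s$ on $\mathbf A^2(\omega,R_\omega)^s\times B(\omega,R_\omega)$, let $\nu_x=\|x-\omega\|/R_\omega$, $c_0=\sum_{k\ge0}(1/2)^{2^k-1}$, and let $\alpha_0$ be the smallest positive root of $(1-4u+2u^2)^2-2u$. **Theorem.** Let $f\in\mathbf A^2(\omega,R_\omega)^s$ and $x\in B(\omega,R_\omega)$ satisfy $$c_0\,(1-\nu_x^2)^{\frac{n+1}2}\,\frac{\|f(x)\|}{R_\omega}+\nu_x<1$$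 and $$\frac{(n+1)(n+2)}2\,(1-\nu_x^2)^{\frac{n-1}2}\left(\frac{\|f\|}{R_\omega}\,\frac1{1-\nu_x^2}+1\right)\frac{\|f(x)\|}{R_\omega}\le\alpha_0 .$$ Then the Newton sequence $$(f^0,x_0)=(f,x),\qquad (f^{k+1},x_{k+1})=(f^k,x_k)-D\,\mathrm{eval}(f^k,x_k)^\dagger\,\mathrm{eval}(f^k,x_k),\quad k\ge0,$$ where $\dagger$ is the Moore–Penrose inverse, is well defined (in particular $x_k\in B(\omega,R_\omega)$ for all $k$) and converges quadratically to some $(g,y)\in\mathbf A^2(\omega,R_\omega)^s\times B(\omega,R_\omega)$ with $g(y)=0$; that is, it converges to $(g,y)$ and for some constant $C$, $\|(f^{k+1},x_{k+1})-(g,y)\|\le C\,\|(f^k,x_k)-(g,y)\|^2$ for all $k$. Moreover $$\left(\|f-g\|^2+\|x-y\|^2\right)^{1/2}\le c_0\,(1-\nu_x^2)^{\frac{n+1}2}\,\|f(x)\| .$$ **Corollary (case $x=\omega$).** If $c_0\|f(\omega)\|/R_\omega<1$ and $\frac{(n+1)(n+2)}2\left(\frac{\|f\|}{R_\omega}+1\right)\frac{\|f(\omega)\|}{R_\omega}\le\alpha_0$,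 then the Newton sequence started at $(f,\omega)$ is well defined and converges quadratically to some $(g,y)\in\mathbf A^2(\omega,R_\omega)^s\times B(\omega,R_\omega)$ with $g(y)=0$ and $\left(\|f-g\|^2+\|\omega-y\|^2\right)^{1/2}\le c_0\|f(\omega)\|$. -/

import Mathlib

open MeasureTheory Metric Filter
open scoped ComplexConjugate Topology

noncomputable section

/-- `ℂⁿ` with its Hermitian norm. -/
abbrev Cn (n : ℕ) : Type := EuclideanSpace ℂ (Fin n)

/-- The analytic square integrable functions on the open ball `B(ω, R)` of `ℂⁿ`, as a complex vector
space.  A function on the ball is represented by its extension by `0` to `ℂⁿ`, so that two elements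
are equal iff they agree on the ball. -/
def bergmanSubmodule {n : ℕ} (ω : Cn n) (R : ℝ) : Submodule ℂ (Cn n → ℂ) where
  carrier := {f | AnalyticOnNhd ℂ f (ball ω R) ∧ MemLp f 2 (volume.restrict (ball ω R)) ∧
    ∀ z, z ∉ ball ω R → f z = 0}
  add_mem' := by
    rintro f g ⟨hf, hf', hf''⟩ ⟨hg, hg', hg''⟩
    refine ⟨hf.add hg, hf'.add hg', fun z hz => ?_⟩
    simp [hf'' z hz, hg'' z hz]
  zero_mem' := ⟨analyticOnNhd_const, MemLp.zero, fun _ _ => rfl⟩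
  smul_mem' := by
    rintro c f ⟨hf, hf', hf''⟩
    refine ⟨fun z hz => (hf z hz).const_smul (c := c), hf'.const_smul c, fun z hz => ?_⟩
    simp [hf'' z hz]

/-- The Bergman space `A²(ω, R)`. -/
def BergmanSpace {n : ℕ} (ω : Cn n) (R : ℝ) : Type := bergmanSubmodule ω R

namespace BergmanSpace

variable {n : ℕ} {ω : Cn n} {R : ℝ}

instance : AddCommGroup (BergmanSpace ω R) :=
  inferInstanceAs (AddCommGroup (bergmanSubmodule ω R))

instance : Module ℂ (BergmanSpace ω R) :=
  inferInstanceAs (Module ℂ (bergmanSubmodule ω R))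

/-- The value `f(z)`, for `z` in the ball (and `0` elsewhere). -/
instance : CoeFun (BergmanSpace ω R) (fun _ => Cn n → ℂ) :=
  ⟨fun f => Subtype.val (p := fun g => g ∈ bergmanSubmodule ω R) f⟩

theorem ext_ball {f g : BergmanSpace ω R} (h : ∀ z ∈ ball ω R, f z = g z) : f = g := by
  apply Subtype.ext
  funext z
  by_cases hz : z ∈ ball ω R
  · exact h z hz
  · exact (f.2.2.2 z hz).trans (g.2.2.2 z hz).symm

theorem add_apply (f g : BergmanSpace ω R) (z : Cn n) : (f + g) z = f z + g z := rfl

theorem smul_apply (c : ℂ) (f : BergmanSpace ω R) (z : Cn n) : (c • f) z = c * f z := rfl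

theorem integrable_conj_mul (f g : BergmanSpace ω R) :
    Integrable (fun z => conj (f z) * g z) (volume.restrict (ball ω R)) :=
  MemLp.integrable_mul (p := 2) (q := 2) f.2.2.1.star g.2.2.1

/-- `n! / (πⁿ R²ⁿ)`, the inverse of the volume of the ball `B(ω, R)` of `ℂⁿ`. -/
def normConst (n : ℕ) (R : ℝ) : ℝ := (n.factorial : ℝ) / Real.pi ^ n / R ^ (2 * n)

/-- The normalized `L²` inner product on the ball.  In Mathlib's convention it is conjugate-linear in
the first argument, hence the conjugate on `f`. -/
instance : Inner ℂ (BergmanSpace ω R) :=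
  ⟨fun f g => (normConst n R : ℂ) * ∫ z in ball ω R, conj (f z) * g z⟩

theorem inner_def (f g : BergmanSpace ω R) :
    inner ℂ f g = (normConst n R : ℂ) * ∫ z in ball ω R, conj (f z) * g z := rfl

theorem inner_self_eq (f : BergmanSpace ω R) :
    inner ℂ f f = ((normConst n R * ∫ z in ball ω R, ‖f z‖ ^ 2 : ℝ) : ℂ) := by
  rw [inner_def, Complex.ofReal_mul, ← integral_complex_ofReal]
  congr 2
  funext z
  rw [mul_comm, Complex.mul_conj, Complex.normSq_eq_norm_sq]

theorem normConst_nonneg (n : ℕ) (R : ℝ) : 0 ≤ normConst n R := by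
  unfold normConst
  rw [pow_mul]
  positivity

abbrev core : InnerProductSpace.Core ℂ (BergmanSpace ω R) where
  conj_inner_symm f g := by
    rw [inner_def, inner_def, map_mul, Complex.conj_ofReal, ← integral_conj]
    congr 2
    funext z
    simp [mul_comm]
  re_inner_nonneg f := by
    rw [inner_self_eq]
    exact mul_nonneg (normConst_nonneg n R) (integral_nonneg fun z => by positivity)
  add_left f g h := by
    simp only [inner_def, add_apply, map_add, add_mul]
    rw [integral_add (integrable_conj_mul f h) (integrable_conj_mul g h), mul_add]
  smul_left f g c := by
    simp only [inner_def, smul_apply, map_mul, mul_assoc]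
    rw [integral_const_mul, mul_left_comm]
  definite f hf := by
    rcases le_or_gt R 0 with hR | hR
    · exact ext_ball fun z hz => by simp [ball_eq_empty.2 hR] at hz
    have hc : normConst n R ≠ 0 := by
      unfold normConst
      positivity
    rw [inner_self_eq, Complex.ofReal_eq_zero, mul_eq_zero, or_iff_right hc] at hf
    have hint : Integrable (fun z => ‖f z‖ ^ 2) (volume.restrict (ball ω R)) :=
      f.2.2.1.integrable_norm_pow (by norm_num)
    rw [integral_eq_zero_iff_of_nonneg (fun z => by positivity) hint] at hf
    have hcont : ContinuousOn (fun z => ‖f z‖ ^ 2) (ball ω R) :=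
      (f.2.1.continuousOn.norm).pow 2
    have h0 := Measure.eqOn_open_of_ae_eq hf isOpen_ball hcont continuousOn_const
    exact ext_ball fun z hz => by
      have := h0 hz
      change ‖f z‖ ^ 2 = 0 at this
      exact norm_eq_zero.1 (pow_eq_zero_iff two_ne_zero |>.1 this)

instance : NormedAddCommGroup (BergmanSpace ω R) :=
  core.toNormedAddCommGroup

instance : InnerProductSpace ℂ (BergmanSpace ω R) :=
  InnerProductSpace.ofCore core.toCore

end BergmanSpace

/-- `A²(ω, R)ˢ` with the inner product `∑ᵢ ⟨fᵢ, gᵢ⟩`. -/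
abbrev BergmanSystem {n : ℕ} (s : ℕ) (ω : Cn n) (R : ℝ) : Type :=
  PiLp 2 (fun _ : Fin s => BergmanSpace ω R)

/-- `A²(ω, R)ˢ × ℂⁿ` with the inner product `⟨f, g⟩ + ⟨x, y⟩`. -/
abbrev SystemPoint {n : ℕ} (s : ℕ) (ω : Cn n) (R : ℝ) : Type :=
  WithLp 2 (BergmanSystem s ω R × Cn n)

/-- The value `f(x) ∈ ℂˢ` of a system. -/
def BergmanSystem.value {n s : ℕ} {ω : Cn n} {R : ℝ} (f : BergmanSystem s ω R) (x : Cn n) : Cn s :=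
  WithLp.toLp 2 fun i => f i x

/-- The evaluation map `(f, x) ↦ f(x)`; it is meant on the open set `A²(ω, R)ˢ × B(ω, R)`. -/
def evalMap {n s : ℕ} {ω : Cn n} {R : ℝ} (p : SystemPoint s ω R) : Cn s :=
  BergmanSystem.value p.fst p.snd

/-- `X` is a Moore–Penrose inverse of `T`: the four Penrose equations. -/
structure IsMoorePenroseInverse {E F : Type*}
    [NormedAddCommGroup E] [InnerProductSpace ℂ E] [NormedAddCommGroup F] [InnerProductSpace ℂ F]
    (T : E →L[ℂ] F) (X : F →L[ℂ] E) : Prop where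
  mul_mul_self : ∀ u, T (X (T u)) = T u
  self_mul_self : ∀ v, X (T (X v)) = X v
  symm_left : ∀ v w, inner ℂ (T (X v)) w = inner ℂ v (T (X w))
  symm_right : ∀ u w, inner ℂ (X (T u)) w = inner ℂ u (X (T w))

/-- A Moore–Penrose inverse is unique. -/
theorem IsMoorePenroseInverse.unique {E F : Type*}
    [NormedAddCommGroup E] [InnerProductSpace ℂ E] [NormedAddCommGroup F] [InnerProductSpace ℂ F]
    {T : E →L[ℂ] F} {X Y : F →L[ℂ] E}
    (hX : IsMoorePenroseInverse T X) (hY : IsMoorePenroseInverse T Y) : X = Y := by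
  have hTT : ∀ v, T (X v) = T (Y v) := fun v => by
    refine ext_inner_right ℂ fun w => ?_
    rw [hX.symm_left, ← hY.mul_mul_self (X w), ← hY.symm_left, ← hX.symm_left,
      hX.mul_mul_self]
  have hXX : ∀ u, X (T u) = Y (T u) := fun u => by
    refine ext_inner_right ℂ fun w => ?_
    have h1 : Y (T u) = Y (T (X (T u))) := by rw [hX.mul_mul_self]
    rw [h1, hY.symm_right, hX.symm_right, hX.symm_right, hY.mul_mul_self]
  ext v
  rw [← hX.self_mul_self v, hTT v, hXX, hY.self_mul_self]

open Classical in
/-- The Moore–Penrose inverse `T†` (with the value `0` if `T` has none, i.e. if `T` is not regular;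
it always exists when `T` is surjective onto a finite-dimensional space and `E` is complete). -/
def moorePenrose {E F : Type*}
    [NormedAddCommGroup E] [InnerProductSpace ℂ E] [NormedAddCommGroup F] [InnerProductSpace ℂ F]
    (T : E →L[ℂ] F) : F →L[ℂ] E :=
  if h : ∃ X, IsMoorePenroseInverse T X then h.choose else 0

theorem IsMoorePenroseInverse.moorePenrose_eq {E F : Type*}
    [NormedAddCommGroup E] [InnerProductSpace ℂ E] [NormedAddCommGroup F] [InnerProductSpace ℂ F]
    {T : E →L[ℂ] F} {X : F →L[ℂ] E} (hX : IsMoorePenroseInverse T X) : moorePenrose T = X := by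
  have h : ∃ X, IsMoorePenroseInverse T X := ⟨X, hX⟩
  rw [moorePenrose, dif_pos h]
  exact h.choose_spec.unique hX

/-- One Newton step for the evaluation map: `p ↦ p - D eval(p)† eval(p)`. -/
def newtonStep {n s : ℕ} {ω : Cn n} {R : ℝ} (p : SystemPoint s ω R) : SystemPoint s ω R :=
  p - moorePenrose (fderiv ℂ (evalMap (s := s) (ω := ω) (R := R)) p) (evalMap p)

/-- The Newton sequence started at `(f, x)`. -/
def newtonSeq {n s : ℕ} {ω : Cn n} {R : ℝ} (f : BergmanSystem s ω R) (x : Cn n) (k : ℕ) :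
    SystemPoint s ω R :=
  newtonStep^[k] (WithLp.toLp 2 (f, x))

/-- The Newton sequence started at `(f, x)` is well defined: every iterate lies in
`A²(ω, R)ˢ × B(ω, R)`, the evaluation map is differentiable there, and its derivative does have a
Moore–Penrose inverse, so that no default value enters the iteration. -/
structure NewtonWellDefined {n s : ℕ} {ω : Cn n} {R : ℝ} (f : BergmanSystem s ω R) (x : Cn n) :
    Prop where
  mem_ball : ∀ k, (newtonSeq f x k).snd ∈ ball ω R
  differentiableAt : ∀ k,
    DifferentiableAt ℂ (evalMap (s := s) (ω := ω) (R := R)) (newtonSeq f x k)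
  isMoorePenroseInverse : ∀ k, IsMoorePenroseInverse
    (fderiv ℂ (evalMap (s := s) (ω := ω) (R := R)) (newtonSeq f x k))
    (moorePenrose (fderiv ℂ (evalMap (s := s) (ω := ω) (R := R)) (newtonSeq f x k)))

/-- Quadratic convergence of a sequence. -/
def ConvergesQuadratically {E : Type*} [NormedAddCommGroup E] (u : ℕ → E) (l : E) : Prop :=
  Tendsto u atTop (𝓝 l) ∧ ∃ C : ℝ, ∀ k, ‖u (k + 1) - l‖ ≤ C * ‖u k - l‖ ^ 2

/-- `ν_x = ‖x - ω‖ / R`. -/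
def nu {n : ℕ} (ω : Cn n) (R : ℝ) (x : Cn n) : ℝ := ‖x - ω‖ / R

/-- `c₀ = ∑_{k ≥ 0} (1/2)^(2^k - 1)`. -/
def c₀ : ℝ := ∑' k : ℕ, (1 / 2 : ℝ) ^ (2 ^ k - 1)

theorem summable_c₀ : Summable fun k : ℕ => (1 / 2 : ℝ) ^ (2 ^ k - 1) := by
  refine Summable.of_nonneg_of_le (fun k => by positivity) (fun k => ?_)
    (summable_geometric_of_lt_one (r := (1 / 2 : ℝ)) (by norm_num) (by norm_num))
  exact pow_le_pow_of_le_one (by norm_num) (by norm_num) (Nat.le_sub_one_of_lt k.lt_two_pow_self)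

/-- The first positive root of `(1 - 4u + 2u²)² - 2u`. -/
def α₀ : ℝ := sInf {u : ℝ | 0 < u ∧ (1 - 4 * u + 2 * u ^ 2) ^ 2 - 2 * u = 0}

theorem isLeast_α₀ : IsLeast {u : ℝ | 0 < u ∧ (1 - 4 * u + 2 * u ^ 2) ^ 2 - 2 * u = 0} α₀ := by
  have hset : {u : ℝ | 0 < u ∧ (1 - 4 * u + 2 * u ^ 2) ^ 2 - 2 * u = 0} =
      Set.Ici 0 ∩ {u : ℝ | (1 - 4 * u + 2 * u ^ 2) ^ 2 - 2 * u = 0} := by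
    ext u
    refine ⟨fun h => ⟨h.1.le, h.2⟩, fun h => ⟨lt_of_le_of_ne h.1 ?_, h.2⟩⟩
    rintro rfl
    have := h.2
    norm_num at this
  have hcont : Continuous fun u : ℝ => (1 - 4 * u + 2 * u ^ 2) ^ 2 - 2 * u := by fun_prop
  have hclosed : IsClosed {u : ℝ | 0 < u ∧ (1 - 4 * u + 2 * u ^ 2) ^ 2 - 2 * u = 0} := by
    rw [hset]
    exact isClosed_Ici.inter (isClosed_singleton.preimage hcont)
  refine hclosed.isLeast_csInf ?_ ⟨0, fun u hu => hu.1.le⟩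
  obtain ⟨u, hu, h0⟩ := intermediate_value_Icc' (by norm_num : (0 : ℝ) ≤ 1 / 4) hcont.continuousOn
    (show (0 : ℝ) ∈ Set.Icc _ _ by constructor <;> norm_num)
  refine ⟨u, ?_⟩
  rw [hset]
  exact ⟨hu.1, h0⟩

end

/-!
The proof replaces an analysis of all higher derivatives of the evaluation map by the Hilbert space
geometry of the Bergman space. Write `δ = 1 - ν_x²` (`ballDefect`), and for a point `(f, x)` let
`b = δ^((n + 1) / 2) ‖f(x)‖`.

*The Bergman kernel.* The automorphism of the ball that sends the centre to `x` (`ballAut`) has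
complex Jacobian `(√δ / (1 + ⟪x, w⟫))^(n + 1)`. Changing variables turns the integral of `f` against
the kernel `(1 - ⟪z, x⟫)^(-(n + 1))` into the integral of a holomorphic function, so the reproducing
property `bergman_reproducing` follows from the mean value property at the centre. Differentiating
under the integral, the first and second derivatives of `f` at `x` in a direction `v` are also inner
products of `f` with explicit kernels. The squared norm of such a kernel is the functional applied to
the kernel itself, hence a derivative of an explicit rational function of one variable. This gives
bounds of the order `δ^(-(n + 3) / 2)` and `δ^(-(n + 5) / 2)` for these derivatives (`norm_deriv_le`,
`norm_deriv_two_le`), and Taylor bounds for the evaluation map (`norm_evalMap_taylor_le`).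
The same integral formula shows that limits in `L²` are analytic, so the Bergman space is complete.

*The Newton step.* The derivative of the evaluation map at `(f, x)` is `(g, v) ↦ g(x) + Df(x) v`.
Multiples of the Bergman kernel at `x` solve `g(x) = c` with `‖g‖ = δ^((n + 1) / 2) ‖c‖`. Since the
Moore–Penrose inverse picks the solution of least norm, its norm is at most `δ^((n + 1) / 2)`, at
every point of the ball and not only at the starting point (`norm_newtonStep_sub_le`).

*Convergence.* Let `βₖ` be the length of the `k`-th Newton step. The new residual is a Taylor
remainder, so the two bounds above give `βₖ₊₁ ≤ a βₖ²` as long as the iterates stay within `c₀ b` of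
the start, where `δ` varies by a relative amount of order `b / (R δ)` only. The hypothesis on `α₀`,
used through `α₀ ≤ 3 / 20`, gives `a b ≤ 1 / 2`. Then `βₖ ≤ (1 / 2)^(2ᵏ - 1) b`, the iterates stay
within `c₀ b` of the start, and they converge quadratically (`convergesQuadratically_iterate`).
-/

noncomputable section

/-! ### The mean value property on the unit ball -/

/-- Multiplication by a complex number of modulus one preserves the volume of `ℂⁿ`. -/
theorem measurePreserving_smul_of_norm_eq_one {n : ℕ} {c : ℂ} (hc : ‖c‖ = 1) :
    MeasurePreserving (fun z : Cn n => c • z) := by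
  have h0 : c ≠ 0 := by
    rintro rfl
    simp at hc
  let e : Cn n ≃ₗᵢ[ℝ] Cn n :=
    { toLinearEquiv := (LinearEquiv.smulOfNeZero ℂ (Cn n) c h0).restrictScalars ℝ
      norm_map' := fun z => by
        change ‖c • z‖ = ‖z‖
        rw [norm_smul, hc, one_mul] }
  exact e.measurePreserving

/-- The mean value property on the unit ball of `ℂⁿ`: average the rotations `z ↦ e^{iθ} z` and use
the mean value property on each complex line through the centre. -/
theorem setIntegral_unitBall_eq {n : ℕ} {f : Cn n → ℂ} (hf : DifferentiableOn ℂ f (ball 0 1))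
    (hint : IntegrableOn f (ball 0 1)) :
    ∫ z in ball (0 : Cn n) 1, f z = (volume : Measure (Cn n)).real (ball 0 1) * f 0 := by
  set B : Set (Cn n) := ball 0 1 with hB
  have hmem : ∀ θ : ℝ, ∀ z : Cn n, circleMap 0 1 θ • z ∈ B ↔ z ∈ B := fun θ z => by
    simp [hB, norm_smul]
  have hpre : ∀ θ : ℝ, (fun z : Cn n => circleMap 0 1 θ • z) ⁻¹' B = B := fun θ => by
    ext z
    exact hmem θ z
  have hmp : ∀ θ : ℝ, MeasurePreserving (fun z : Cn n => circleMap 0 1 θ • z)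
      (volume.restrict B) (volume.restrict B) := fun θ => by
    have := (measurePreserving_smul_of_norm_eq_one (n := n) (c := circleMap 0 1 θ)
      (by simp)).restrict_preimage (s := B) measurableSet_ball
    rwa [hpre] at this
  have hemb : ∀ θ : ℝ, MeasurableEmbedding (fun z : Cn n => circleMap 0 1 θ • z) := fun θ =>
    (Homeomorph.smulOfNeZero (circleMap 0 1 θ)
      (circleMap_ne_center one_ne_zero)).measurableEmbedding
  have hrot : ∀ θ : ℝ, ∫ z in B, f (circleMap 0 1 θ • z) = ∫ z in B, f z := fun θ =>
    (hmp θ).integral_comp (hemb θ) f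
  have hrotn : ∀ θ : ℝ, ∫ z in B, ‖f (circleMap 0 1 θ • z)‖ = ∫ z in B, ‖f z‖ := fun θ =>
    (hmp θ).integral_comp (hemb θ) fun z => ‖f z‖
  have hcirc : ∀ z ∈ B, ∫ θ in Set.Ioc 0 (2 * Real.pi), f (circleMap 0 1 θ • z)
      = (2 * Real.pi : ℝ) * f 0 := fun z hz => by
    have hz1 : ‖z‖ < 1 := by simpa [hB] using hz
    have hd : DiffContOnCl ℂ (fun ζ : ℂ => f (ζ • z)) (ball 0 |1|) := by
      apply DifferentiableOn.diffContOnCl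
      have hmaps : Set.MapsTo (fun ζ : ℂ => ζ • z) (closure (ball (0 : ℂ) |1|)) B := by
        intro ζ hζ
        rw [abs_one, closure_ball _ one_ne_zero] at hζ
        have hζ1 : ‖ζ‖ ≤ 1 := by simpa using hζ
        rw [hB, mem_ball_zero_iff, norm_smul]
        exact (mul_le_of_le_one_left (norm_nonneg z) hζ1).trans_lt hz1
      exact hf.comp (by fun_prop) hmaps
    have h := hd.circleAverage
    rw [Real.circleAverage_def, zero_smul,
      intervalIntegral.integral_of_le (by positivity)] at h
    rw [← h, Complex.real_smul, ← mul_assoc, ← Complex.ofReal_mul,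
      mul_inv_cancel₀ (by positivity), Complex.ofReal_one, one_mul]
  have hcont : ContinuousOn (fun p : ℝ × Cn n => f (circleMap 0 1 p.1 • p.2))
      (Set.Ioc 0 (2 * Real.pi) ×ˢ B) := by
    refine hf.continuousOn.comp (Continuous.continuousOn ?_) fun p hp => (hmem p.1 p.2).2 hp.2
    have : Continuous (circleMap 0 1) := continuous_circleMap 0 1
    fun_prop
  have hprod : Integrable (Function.uncurry fun (θ : ℝ) (z : Cn n) => f (circleMap 0 1 θ • z))
      ((volume.restrict (Set.Ioc 0 (2 * Real.pi))).prod (volume.restrict B)) := by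
    rw [integrable_prod_iff]
    · refine ⟨Eventually.of_forall fun θ => ?_, ?_⟩
      · exact (hmp θ).integrable_comp_of_integrable hint
      · simp only [Function.uncurry_apply_pair, hrotn]
        exact integrable_const _
    · rw [Measure.prod_restrict]
      exact hcont.aestronglyMeasurable (measurableSet_Ioc.prod measurableSet_ball)
  have hswap := integral_integral_swap hprod
  simp only [hrot, integral_const] at hswap
  rw [setIntegral_congr_fun measurableSet_ball hcirc, setIntegral_const] at hswap
  have hpi : ((2 * Real.pi : ℝ) : ℂ) ≠ 0 := by
    exact_mod_cast Real.two_pi_pos.ne'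
  have hreal : (volume.restrict (Set.Ioc 0 (2 * Real.pi))).real Set.univ = 2 * Real.pi := by
    simp [measureReal_def, Real.pi_pos.le]
  rw [hreal, Complex.real_smul, Complex.real_smul, mul_left_comm] at hswap
  exact mul_left_cancel₀ hpi hswap

/-- The volume of the unit ball of `ℂⁿ`. -/
theorem volume_real_unitBall {n : ℕ} (hn : 1 ≤ n) :
    (volume : Measure (Cn n)).real (ball 0 1) = Real.pi ^ n / n.factorial := by
  have : NeZero n := ⟨by omega⟩
  have hfr : Module.finrank ℝ (Cn n) = 2 * n := by
    rw [← Module.finrank_mul_finrank ℝ ℂ (Cn n), Complex.finrank_real_complex,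
      finrank_euclideanSpace_fin]
  have : Nontrivial (Cn n) := Module.nontrivial_of_finrank_pos (R := ℝ) (by omega)
  rw [measureReal_def, InnerProductSpace.volume_ball_of_dim_even hfr]
  rw [ENNReal.ofReal_one, one_pow, one_mul, ENNReal.toReal_ofReal (by positivity)]

/-! ### Automorphisms of the unit ball -/

/-- The linear map `s • id + (1 + s)⁻¹ x x^*` with `s = √(1 - ‖x‖²)`. It is the positive square root
of `(1 - ‖x‖²) • id + x x^*` when `‖x‖ < 1`. -/
def ballAutLin {n : ℕ} (x : Cn n) : Cn n →L[ℂ] Cn n :=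
  ((√(1 - ‖x‖ ^ 2) : ℝ) : ℂ) • ContinuousLinearMap.id ℂ (Cn n) +
    (innerSL ℂ x).smulRight ((((1 + √(1 - ‖x‖ ^ 2))⁻¹ : ℝ) : ℂ) • x)

theorem ballAutLin_apply {n : ℕ} (x w : Cn n) :
    ballAutLin x w = ((√(1 - ‖x‖ ^ 2) : ℝ) : ℂ) • w +
      (inner ℂ x w * (((1 + √(1 - ‖x‖ ^ 2))⁻¹ : ℝ) : ℂ)) • x := by
  simp [ballAutLin, smul_smul]

/-- The automorphism of the unit ball of `ℂⁿ` that sends `0` to `x`, for `‖x‖ < 1`. -/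
def ballAut {n : ℕ} (x w : Cn n) : Cn n :=
  (1 + inner ℂ x w)⁻¹ • (x + ballAutLin x w)

theorem norm_inner_lt_one {n : ℕ} {x w : Cn n} (hx : ‖x‖ < 1) (hw : ‖w‖ ≤ 1) :
    ‖inner ℂ x w‖ < 1 :=
  (norm_inner_le_norm x w).trans_lt
    ((mul_le_of_le_one_right (norm_nonneg x) hw).trans_lt hx)

theorem one_add_inner_ne_zero {n : ℕ} {x w : Cn n} (hx : ‖x‖ < 1) (hw : ‖w‖ ≤ 1) :
    1 + inner ℂ x w ≠ 0 := fun h => by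
  have h1 := norm_inner_lt_one hx hw
  rw [eq_neg_of_add_eq_zero_right h, norm_neg, norm_one] at h1
  exact lt_irrefl _ h1

theorem one_sub_inner_ne_zero {n : ℕ} {x w : Cn n} (hx : ‖x‖ < 1) (hw : ‖w‖ ≤ 1) :
    1 - inner ℂ x w ≠ 0 := fun h => by
  have h1 := norm_inner_lt_one hx hw
  rw [← sub_eq_zero.1 h, norm_one] at h1
  exact lt_irrefl _ h1

theorem one_sub_norm_sq_pos {n : ℕ} {x : Cn n} (hx : ‖x‖ < 1) : 0 < 1 - ‖x‖ ^ 2 := by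
  nlinarith [norm_nonneg x]

theorem inner_self_eq_of_norm_lt_one {n : ℕ} {x : Cn n} (hx : ‖x‖ < 1) :
    inner ℂ x x = (((1 - √(1 - ‖x‖ ^ 2)) * (1 + √(1 - ‖x‖ ^ 2)) : ℝ) : ℂ) := by
  have h : (1 - √(1 - ‖x‖ ^ 2)) * (1 + √(1 - ‖x‖ ^ 2)) = ‖x‖ ^ 2 := by
    have := Real.sq_sqrt (one_sub_norm_sq_pos hx).le
    linarith
  rw [inner_self_eq_norm_sq_to_K, h]
  simp

/-- `x` is fixed by the self-adjoint map `ballAutLin x`. -/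
theorem inner_ballAutLin {n : ℕ} {x : Cn n} (hx : ‖x‖ < 1) (w : Cn n) :
    inner ℂ x (ballAutLin x w) = inner ℂ x w := by
  have hδ := one_sub_norm_sq_pos hx
  set s := √(1 - ‖x‖ ^ 2) with hs
  have hs0 : 0 < s := Real.sqrt_pos.2 hδ
  have hxx := inner_self_eq_of_norm_lt_one hx
  rw [← hs] at hxx
  have h1 : (1 + s : ℂ) ≠ 0 := by
    exact_mod_cast (by positivity : (1 + s : ℝ) ≠ 0)
  rw [ballAutLin_apply, inner_add_right, inner_smul_right, inner_smul_right, hxx, ← hs]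
  push_cast
  field_simp
  ring

theorem inner_ballAut {n : ℕ} {x w : Cn n} (hx : ‖x‖ < 1) (hw : ‖w‖ ≤ 1) :
    1 - inner ℂ x (ballAut x w) = ((1 - ‖x‖ ^ 2 : ℝ) : ℂ) / (1 + inner ℂ x w) := by
  have hc := one_add_inner_ne_zero hx hw
  rw [ballAut, inner_smul_right, inner_add_right, inner_ballAutLin hx,
    inner_self_eq_norm_sq_to_K]
  field_simp
  push_cast
  simp

/-- The identity `|1 + ⟪x, w⟫|² - ‖x + T w‖² = (1 - ‖x‖²) (1 - ‖w‖²)` for `T = ballAutLin x`. -/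
theorem normSq_add_ballAutLin {n : ℕ} {x : Cn n} (hx : ‖x‖ < 1) (w : Cn n) :
    ‖x + ballAutLin x w‖ ^ 2 =
      ‖1 + inner ℂ x w‖ ^ 2 - (1 - ‖x‖ ^ 2) * (1 - ‖w‖ ^ 2) := by
  have hδ := one_sub_norm_sq_pos hx
  have hfix := inner_ballAutLin hx w
  set s := √(1 - ‖x‖ ^ 2) with hs
  have hs0 : 0 < s := Real.sqrt_pos.2 hδ
  have hs2 : s ^ 2 = 1 - ‖x‖ ^ 2 := Real.sq_sqrt hδ.le
  have hT : ‖ballAutLin x w‖ ^ 2 = s ^ 2 * ‖w‖ ^ 2 + ‖(inner ℂ x w : ℂ)‖ ^ 2 := by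
    -- `‖T w‖² = ⟪T w, s w⟫ + ⟪T w, (1 + s)⁻¹ ⟪x, w⟫ x⟫` and `⟪x, T w⟫ = ⟪x, w⟫`
    have h1 : ‖ballAutLin x w‖ ^ 2 = RCLike.re (inner ℂ (ballAutLin x w) (ballAutLin x w)) :=
      (inner_self_eq_norm_sq _).symm
    have h2 : inner ℂ (ballAutLin x w) (ballAutLin x w) =
        ((s ^ 2 * ‖w‖ ^ 2 + ‖(inner ℂ x w : ℂ)‖ ^ 2 : ℝ) : ℂ) := by
      have h3 : inner ℂ (ballAutLin x w) x = conj (inner ℂ x w : ℂ) := by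
        rw [← inner_conj_symm, hfix]
      have h4 : inner ℂ (ballAutLin x w) w =
          (s : ℂ) * (‖w‖ : ℂ) ^ 2 + conj (inner ℂ x w : ℂ) * ((1 + s)⁻¹ : ℝ) * inner ℂ x w := by
        rw [ballAutLin_apply, inner_add_left, inner_smul_left, inner_smul_left,
          inner_self_eq_norm_sq_to_K, ← hs, map_mul, Complex.conj_ofReal, Complex.conj_ofReal]
        rfl
      have h5 : ∀ a : ℂ, conj a * a = ((‖a‖ ^ 2 : ℝ) : ℂ) := fun a => by
        rw [mul_comm, Complex.mul_conj, Complex.normSq_eq_norm_sq]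
      have h6 : (1 + s : ℂ) ≠ 0 := by
        exact_mod_cast (by positivity : (1 + s : ℝ) ≠ 0)
      conv_lhs => rw [ballAutLin_apply x w, inner_add_right, inner_smul_right, inner_smul_right,
        ← ballAutLin_apply x w]
      rw [h3, h4, ← hs]
      have h7 := h5 (inner ℂ x w)
      push_cast at h7 ⊢
      rw [← h7]
      field_simp
      ring
    rw [h1, h2]
    exact Complex.ofReal_re _
  rw [@norm_add_sq ℂ, hT, hfix, hs2]
  have h8 : ‖(1 + inner ℂ x w : ℂ)‖ ^ 2 = 1 + 2 * RCLike.re (inner ℂ x w) +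
      ‖(inner ℂ x w : ℂ)‖ ^ 2 := by
    rw [@norm_add_sq ℂ ℂ]
    simp
  rw [h8]
  ring

theorem one_sub_normSq_ballAut {n : ℕ} {x w : Cn n} (hx : ‖x‖ < 1) (hw : ‖w‖ ≤ 1) :
    1 - ‖ballAut x w‖ ^ 2 = (1 - ‖x‖ ^ 2) * (1 - ‖w‖ ^ 2) / ‖1 + inner ℂ x w‖ ^ 2 := by
  have hc : ‖1 + inner ℂ x w‖ ≠ 0 := norm_ne_zero_iff.2 (one_add_inner_ne_zero hx hw)
  rw [ballAut, norm_smul, norm_inv, mul_pow, normSq_add_ballAutLin hx]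
  field_simp
  ring

theorem norm_ballAut_lt_one {n : ℕ} {x w : Cn n} (hx : ‖x‖ < 1) (hw : ‖w‖ < 1) :
    ‖ballAut x w‖ < 1 := by
  have h := one_sub_normSq_ballAut hx hw.le
  have h1 : 0 < ‖1 + inner ℂ x w‖ := norm_pos_iff.2 (one_add_inner_ne_zero hx hw.le)
  have h2 : 0 < (1 - ‖x‖ ^ 2) * (1 - ‖w‖ ^ 2) / ‖1 + inner ℂ x w‖ ^ 2 :=
    div_pos (mul_pos (one_sub_norm_sq_pos hx) (one_sub_norm_sq_pos hw)) (by positivity)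
  nlinarith [norm_nonneg (ballAut x w)]

theorem ballAutLin_neg {n : ℕ} (x w : Cn n) : ballAutLin (-x) w = ballAutLin x w := by
  simp [ballAutLin_apply]

theorem ballAutLin_self {n : ℕ} {x : Cn n} (hx : ‖x‖ < 1) : ballAutLin x x = x := by
  have hδ := one_sub_norm_sq_pos hx
  set s := √(1 - ‖x‖ ^ 2) with hs
  have hs0 : 0 < s := Real.sqrt_pos.2 hδ
  have hxx := inner_self_eq_of_norm_lt_one hx
  rw [← hs] at hxx
  rw [ballAutLin_apply, ← add_smul, hxx, ← hs, ← Complex.ofReal_mul, ← Complex.ofReal_add,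
    mul_assoc, mul_inv_cancel₀ (by positivity), mul_one, add_sub_cancel, Complex.ofReal_one,
    one_smul]

theorem ballAutLin_ballAutLin {n : ℕ} {x : Cn n} (hx : ‖x‖ < 1) (w : Cn n) :
    ballAutLin x (ballAutLin x w) = ((1 - ‖x‖ ^ 2 : ℝ) : ℂ) • w + (inner ℂ x w : ℂ) • x := by
  have hδ := one_sub_norm_sq_pos hx
  have h1 : (((1 + √(1 - ‖x‖ ^ 2)) : ℝ) : ℂ) ≠ 0 := by
    exact_mod_cast (by positivity : (1 + √(1 - ‖x‖ ^ 2)) ≠ 0)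
  conv_lhs => rw [ballAutLin_apply x w, map_add, map_smul, map_smul, ballAutLin_self hx,
    ballAutLin_apply x w]
  rw [smul_add, smul_smul, smul_smul, add_assoc, ← add_smul, ← Complex.ofReal_mul,
    Real.mul_self_sqrt hδ.le]
  congr 2
  push_cast at h1 ⊢
  field_simp
  ring

/-- The inverse of `ballAut (-x)` is `ballAut x`. -/
theorem ballAut_ballAut_neg {n : ℕ} {x w : Cn n} (hx : ‖x‖ < 1) (hw : ‖w‖ ≤ 1) :
    ballAut x (ballAut (-x) w) = w := by
  have hδ : ((1 - ‖x‖ ^ 2 : ℝ) : ℂ) ≠ 0 := by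
    exact_mod_cast (one_sub_norm_sq_pos hx).ne'
  have hc : 1 - inner ℂ x w ≠ 0 := one_sub_inner_ne_zero hx hw
  have h1 := inner_ballAut (x := -x) (w := w) (by rwa [norm_neg]) hw
  rw [inner_neg_left, inner_neg_left, sub_neg_eq_add, norm_neg, ← sub_eq_add_neg] at h1
  have h2 : x + ballAutLin x (ballAut (-x) w) =
      (((1 - ‖x‖ ^ 2 : ℝ) : ℂ) / (1 - inner ℂ x w)) • w := by
    rw [ballAut, inner_neg_left, ← sub_eq_add_neg, map_smul, map_add, map_neg,
      ballAutLin_self hx, ballAutLin_neg, ballAutLin_ballAutLin hx]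
    match_scalars <;> field_simp
    ring
  rw [ballAut, h1, h2, smul_smul, inv_mul_cancel₀ (div_ne_zero hδ hc), one_smul]

theorem ballAut_neg_ballAut {n : ℕ} {x w : Cn n} (hx : ‖x‖ < 1) (hw : ‖w‖ ≤ 1) :
    ballAut (-x) (ballAut x w) = w := by
  simpa using ballAut_ballAut_neg (x := -x) (w := w) (by rwa [norm_neg]) hw

theorem ballAut_zero {n : ℕ} (x : Cn n) : ballAut x 0 = x := by
  simp [ballAut]

/-- The derivative of `ballAut x` at `w`, written as a rank one perturbation of
`ballAutLin x`. -/
def ballAutDeriv {n : ℕ} (x w : Cn n) : Cn n →L[ℂ] Cn n :=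
  (1 + inner ℂ x w)⁻¹ • (ballAutLin x).comp
    (ContinuousLinearMap.id ℂ (Cn n) -
      (innerSL ℂ x).smulRight ((1 + inner ℂ x w)⁻¹ • (x + w)))

theorem hasFDerivAt_ballAut {n : ℕ} {x w : Cn n} (hx : ‖x‖ < 1) (hw : ‖w‖ ≤ 1) :
    HasFDerivAt (ballAut x) (ballAutDeriv x w) w := by
  have hc := one_add_inner_ne_zero hx hw
  have h1 : HasFDerivAt (fun w : Cn n => 1 + inner ℂ x w) (innerSL ℂ x) w :=
    (innerSL ℂ x).hasFDerivAt.const_add 1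
  have h2 : HasFDerivAt (fun w : Cn n => (1 + inner ℂ x w)⁻¹)
      ((-((1 + inner ℂ x w) ^ 2)⁻¹) • innerSL ℂ x) w :=
    (hasDerivAt_inv hc).comp_hasFDerivAt w h1
  have h3 : HasFDerivAt (fun w => x + ballAutLin x w) (ballAutLin x) w :=
    (ballAutLin x).hasFDerivAt.const_add x
  refine (h2.smul h3).congr_fderiv ?_
  ext1 v
  simp only [ballAutDeriv, add_apply, smul_apply,
    ContinuousLinearMap.smulRight_apply, ContinuousLinearMap.comp_apply,
    sub_apply, ContinuousLinearMap.id_apply, innerSL_apply_apply, map_sub,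
    map_smul, map_add, ballAutLin_self hx]
  match_scalars <;> simp <;> field_simp

/-- The determinant of `id + a v^*`. -/
theorem det_id_add_smulRight {n : ℕ} (ℓ : Cn n →L[ℂ] ℂ) (a : Cn n) :
    LinearMap.det ((ContinuousLinearMap.id ℂ (Cn n) + ℓ.smulRight a : Cn n →L[ℂ] Cn n) :
      Cn n →ₗ[ℂ] Cn n) = 1 + ℓ a :=
  LinearMap.transvection.det (ℓ : Cn n →ₗ[ℂ] ℂ) a

theorem det_ballAutLin {n : ℕ} {x : Cn n} (hx : ‖x‖ < 1) :
    ((√(1 - ‖x‖ ^ 2) : ℝ) : ℂ) * LinearMap.det (ballAutLin x : Cn n →ₗ[ℂ] Cn n) =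
      ((√(1 - ‖x‖ ^ 2) : ℝ) : ℂ) ^ n := by
  have hδ := one_sub_norm_sq_pos hx
  set s := √(1 - ‖x‖ ^ 2) with hs
  have hs0 : 0 < s := Real.sqrt_pos.2 hδ
  have hxx := inner_self_eq_of_norm_lt_one hx
  rw [← hs] at hxx
  have hsC : (s : ℂ) ≠ 0 := by exact_mod_cast hs0.ne'
  have h1 : (1 + s : ℂ) ≠ 0 := by
    exact_mod_cast (by positivity : (1 + s : ℝ) ≠ 0)
  have h2 : ballAutLin x = (s : ℂ) • (ContinuousLinearMap.id ℂ (Cn n) +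
      (innerSL ℂ x).smulRight (((s * (1 + s))⁻¹ : ℝ) • x)) := by
    ext1 w
    simp only [ballAutLin_apply, ← hs, smul_apply,
      add_apply, ContinuousLinearMap.id_apply,
      ContinuousLinearMap.smulRight_apply, innerSL_apply_apply, ← Complex.coe_smul]
    match_scalars <;> field_simp
  have h3 := det_id_add_smulRight (innerSL ℂ x) (((s * (1 + s))⁻¹ : ℝ) • x)
  rw [h2, ContinuousLinearMap.toLinearMap_smul, LinearMap.det_smul, h3, finrank_euclideanSpace_fin,
    innerSL_apply_apply, ← Complex.coe_smul, inner_smul_right, hxx, mul_left_comm]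
  push_cast
  field_simp
  ring

theorem det_ballAutDeriv {n : ℕ} {x w : Cn n} (hx : ‖x‖ < 1) (hw : ‖w‖ ≤ 1) :
    LinearMap.det (ballAutDeriv x w : Cn n →ₗ[ℂ] Cn n) =
      (((√(1 - ‖x‖ ^ 2) : ℝ) : ℂ) / (1 + inner ℂ x w)) ^ (n + 1) := by
  have hδ := one_sub_norm_sq_pos hx
  have hc := one_add_inner_ne_zero hx hw
  have h1 := det_ballAutLin hx
  have h2 : ContinuousLinearMap.id ℂ (Cn n) -
      (innerSL ℂ x).smulRight ((1 + inner ℂ x w)⁻¹ • (x + w)) =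
      ContinuousLinearMap.id ℂ (Cn n) +
      (innerSL ℂ x).smulRight (-((1 + inner ℂ x w)⁻¹ • (x + w))) := by
    ext1 v
    simp [sub_eq_add_neg]
  have h3 : ((√(1 - ‖x‖ ^ 2) : ℝ) : ℂ) ^ 2 = ((1 - ‖x‖ ^ 2 : ℝ) : ℂ) := by
    rw [← Complex.ofReal_pow, Real.sq_sqrt hδ.le]
  rw [ballAutDeriv, ContinuousLinearMap.toLinearMap_smul, LinearMap.det_smul,
    ContinuousLinearMap.toLinearMap_comp, LinearMap.det_comp, h2, det_id_add_smulRight,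
    finrank_euclideanSpace_fin,
    map_neg, map_smul, map_add, innerSL_apply_apply, innerSL_apply_apply, inner_self_eq_norm_sq_to_K,
    smul_eq_mul]
  have h4 : 1 + -((1 + inner ℂ x w)⁻¹ * ((‖x‖ : ℂ) ^ 2 + inner ℂ x w)) =
      ((√(1 - ‖x‖ ^ 2) : ℝ) : ℂ) ^ 2 * (1 + inner ℂ x w)⁻¹ := by
    rw [h3]
    push_cast
    field_simp
    ring
  change _ * (_ * (1 + -((1 + inner ℂ x w)⁻¹ * ((‖x‖ : ℂ) ^ 2 + inner ℂ x w)))) = _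
  rw [h4, div_pow, pow_succ _ n, ← h1, inv_pow]
  field_simp
  ring

/-! ### The reproducing property of the Bergman kernel -/

/-- The coordinate `(z - ω) / R`, in which the ball `B(ω, R)` is the unit ball. -/
def ballCoord {n : ℕ} (ω : Cn n) (R : ℝ) (z : Cn n) : Cn n := (R⁻¹ : ℝ) • (z - ω)

theorem norm_ballCoord_eq_nu {n : ℕ} (ω : Cn n) {R : ℝ} (hR : 0 < R) (z : Cn n) :
    ‖ballCoord ω R z‖ = nu ω R z := by
  rw [ballCoord, norm_smul, Real.norm_of_nonneg (inv_nonneg.2 hR.le), nu, inv_mul_eq_div]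

theorem norm_ballCoord_lt_one {n : ℕ} {ω : Cn n} {R : ℝ} (hR : 0 < R) {z : Cn n} :
    ‖ballCoord ω R z‖ < 1 ↔ z ∈ ball ω R := by
  rw [norm_ballCoord_eq_nu ω hR, nu, div_lt_one hR, mem_ball_iff_norm]

theorem image_ballAut {n : ℕ} {x : Cn n} (hx : ‖x‖ < 1) {ω : Cn n} {R : ℝ} (hR : 0 < R) :
    (fun w => ω + R • ballAut x w) '' ball 0 1 = ball ω R := by
  ext z
  constructor
  · rintro ⟨w, hw, rfl⟩
    have hw1 : ‖w‖ < 1 := by simpa using hw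
    rw [← norm_ballCoord_lt_one hR, ballCoord, add_sub_cancel_left, smul_smul,
      inv_mul_cancel₀ hR.ne', one_smul]
    exact norm_ballAut_lt_one hx hw1
  · intro hz
    have hz1 := (norm_ballCoord_lt_one hR).2 hz
    refine ⟨ballAut (-x) (ballCoord ω R z), ?_, ?_⟩
    · rw [mem_ball_zero_iff]
      exact norm_ballAut_lt_one (by rwa [norm_neg]) hz1
    · change ω + R • ballAut x (ballAut (-x) (ballCoord ω R z)) = z
      rw [ballAut_ballAut_neg hx hz1.le, ballCoord, smul_smul, mul_inv_cancel₀ hR.ne', one_smul,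
        add_sub_cancel]

theorem injOn_ballAut {n : ℕ} {x : Cn n} (hx : ‖x‖ < 1) (ω : Cn n) {R : ℝ} (hR : 0 < R) :
    Set.InjOn (fun w => ω + R • ballAut x w) (ball 0 1) := by
  intro w hw v hv h
  have h1 : ballAut x w = ballAut x v := smul_right_injective _ hR.ne' (add_left_cancel h)
  rw [mem_ball_zero_iff] at hw hv
  rw [← ballAut_neg_ballAut hx hw.le, h1, ballAut_neg_ballAut hx hv.le]

/-- The real Jacobian of a holomorphic map is the squared modulus of the complex one. -/
theorem abs_det_restrictScalars {n : ℕ} (T : Cn n →L[ℂ] Cn n) :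
    |(T.restrictScalars ℝ).det| = ‖LinearMap.det (T : Cn n →ₗ[ℂ] Cn n)‖ ^ 2 := by
  have h : (T.restrictScalars ℝ).det = Algebra.norm ℝ (LinearMap.det (T : Cn n →ₗ[ℂ] Cn n)) :=
    LinearMap.det_restrictScalars (R := ℝ) (f := (T : Cn n →ₗ[ℂ] Cn n))
  rw [h, Algebra.norm_complex_apply, Complex.normSq_eq_norm_sq, abs_of_nonneg (by positivity)]

theorem hasFDerivAt_add_smul_ballAut {n : ℕ} {x w : Cn n} (hx : ‖x‖ < 1) (hw : ‖w‖ ≤ 1)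
    (ω : Cn n) (R : ℝ) :
    HasFDerivAt (fun w => ω + R • ballAut x w) ((R : ℂ) • ballAutDeriv x w) w := by
  have h := ((hasFDerivAt_ballAut hx hw).const_smul (R : ℂ)).const_add ω
  refine h.congr_of_eventuallyEq (Eventually.of_forall fun v => ?_)
  simp [Complex.coe_smul]

theorem abs_det_smul_ballAutDeriv {n : ℕ} {x w : Cn n} (hx : ‖x‖ < 1) (hw : ‖w‖ ≤ 1)
    {R : ℝ} (hR : 0 < R) :
    |(((R : ℂ) • ballAutDeriv x w).restrictScalars ℝ).det| =
      R ^ (2 * n) * ((1 - ‖x‖ ^ 2) / ‖1 + inner ℂ x w‖ ^ 2) ^ (n + 1) := by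
  rw [abs_det_restrictScalars, ContinuousLinearMap.toLinearMap_smul, LinearMap.det_smul,
    det_ballAutDeriv hx hw, finrank_euclideanSpace_fin, norm_mul, norm_pow, norm_pow, norm_div,
    Complex.norm_real, Complex.norm_real, Real.norm_of_nonneg hR.le,
    Real.norm_of_nonneg (Real.sqrt_nonneg _), mul_pow, ← pow_mul, mul_comm n 2, ← pow_mul,
    mul_comm (n + 1) 2, pow_mul _ 2 (n + 1), div_pow, Real.sq_sqrt (one_sub_norm_sq_pos hx).le]

/-- The kernel `(1 - ⟪(z - ω) / R, (x - ω) / R⟫)⁻¹`, holomorphic in `x` and antiholomorphic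
in `z`. -/
def ballKernel {n : ℕ} (ω : Cn n) (R : ℝ) (z x : Cn n) : ℂ :=
  (1 - inner ℂ (ballCoord ω R z) (ballCoord ω R x))⁻¹

/-- The reproducing property of the Bergman kernel. The automorphism of the ball that sends the
centre to `x` turns it into the mean value property at the centre. -/
theorem bergman_reproducing {n : ℕ} (hn : 1 ≤ n) {ω : Cn n} {R : ℝ} (hR : 0 < R)
    {f : Cn n → ℂ} (hf : DifferentiableOn ℂ f (ball ω R)) {x : Cn n} (hx : x ∈ ball ω R)
    (hint : IntegrableOn (fun z => ballKernel ω R z x ^ (n + 1) * f z) (ball ω R)) :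
    (BergmanSpace.normConst n R : ℂ) * ∫ z in ball ω R, ballKernel ω R z x ^ (n + 1) * f z = f x := by
  set a := ballCoord ω R x with ha
  have ha1 : ‖a‖ < 1 := (norm_ballCoord_lt_one hR).2 hx
  have hδ : (1 - ‖a‖ ^ 2) ≠ 0 := (one_sub_norm_sq_pos ha1).ne'
  have hδC : ((1 - ‖a‖ ^ 2 : ℝ) : ℂ) ≠ 0 := by exact_mod_cast hδ
  have hwn : ∀ w ∈ ball (0 : Cn n) 1, ‖w‖ ≤ 1 := fun w hw => (mem_ball_zero_iff.1 hw).le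
  have hderiv : ∀ w ∈ ball (0 : Cn n) 1, HasFDerivWithinAt (fun w => ω + R • ballAut a w)
      (((R : ℂ) • ballAutDeriv a w).restrictScalars ℝ) (ball 0 1) w := fun w hw =>
    ((hasFDerivAt_add_smul_ballAut ha1 (hwn w hw) ω R).restrictScalars ℝ).hasFDerivWithinAt
  set F : Cn n → ℂ := fun w => f (ω + R • ballAut a w) * ((1 + inner ℂ a w)⁻¹) ^ (n + 1) with hF
  have hcoord : ∀ w, ballCoord ω R (ω + R • ballAut a w) = ballAut a w := fun w => by
    rw [ballCoord, add_sub_cancel_left, smul_smul, inv_mul_cancel₀ hR.ne', one_smul]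
  -- the Jacobian turns the antiholomorphic kernel into a holomorphic factor
  have hpt : ∀ w ∈ ball (0 : Cn n) 1,
      |(((R : ℂ) • ballAutDeriv a w).restrictScalars ℝ).det| •
        (ballKernel ω R (ω + R • ballAut a w) x ^ (n + 1) * f (ω + R • ballAut a w)) =
      ((R ^ (2 * n) : ℝ) : ℂ) * F w := fun w hw => by
    have hc := one_add_inner_ne_zero ha1 (hwn w hw)
    have h1 : ballKernel ω R (ω + R • ballAut a w) x =
        conj (1 + inner ℂ a w) / ((1 - ‖a‖ ^ 2 : ℝ) : ℂ) := by
      have h2 := congrArg conj (inner_ballAut ha1 (hwn w hw))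
      rw [map_sub, map_one, inner_conj_symm, map_div₀, Complex.conj_ofReal] at h2
      rw [ballKernel, hcoord, ← ha, h2, inv_div]
    have h3 : ((‖1 + inner ℂ a w‖ ^ 2 : ℝ) : ℂ) =
        (1 + inner ℂ a w) * conj (1 + inner ℂ a w) := by
      rw [Complex.mul_conj, Complex.normSq_eq_norm_sq]
    have hc' : conj (1 + inner ℂ a w) ≠ 0 := (map_ne_zero _).2 hc
    rw [abs_det_smul_ballAutDeriv ha1 (hwn w hw) hR, Complex.real_smul, h1, hF,
      Complex.ofReal_mul, Complex.ofReal_pow (_ / _), Complex.ofReal_div, h3, mul_assoc,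
      ← mul_assoc (_ ^ (n + 1)), ← mul_pow]
    change _ = _ * (f _ * _)
    rw [mul_comm (f _)]
    congr 3
    field_simp
  have himg := image_ballAut ha1 (ω := ω) hR
  have hcv := integral_image_eq_integral_abs_det_fderiv_smul volume measurableSet_ball hderiv
    (injOn_ballAut ha1 ω hR) fun z => ballKernel ω R z x ^ (n + 1) * f z
  have hci := (integrableOn_image_iff_integrableOn_abs_det_fderiv_smul volume measurableSet_ball
    hderiv (injOn_ballAut ha1 ω hR) fun z => ballKernel ω R z x ^ (n + 1) * f z).1 (by rwa [himg])
  have hR2 : ((R ^ (2 * n) : ℝ) : ℂ) ≠ 0 := by exact_mod_cast (pow_pos hR _).ne'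
  have hFint : IntegrableOn F (ball 0 1) := by
    have h1 : IntegrableOn (fun w => ((R ^ (2 * n) : ℝ) : ℂ)⁻¹ * (((R ^ (2 * n) : ℝ) : ℂ) * F w))
        (ball 0 1) := (hci.congr_fun hpt measurableSet_ball).const_mul _
    simpa only [← mul_assoc, inv_mul_cancel₀ hR2, one_mul] using h1
  have hFd : DifferentiableOn ℂ F (ball 0 1) := by
    have hd : DifferentiableOn ℂ (fun w => ω + R • ballAut a w) (ball 0 1) := fun w hw =>
      (hasFDerivAt_add_smul_ballAut ha1 (hwn w hw) ω R).differentiableAt.differentiableWithinAt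
    have hmaps : Set.MapsTo (fun w => ω + R • ballAut a w) (ball 0 1) (ball ω R) := fun w hw => by
      rw [← himg]
      exact ⟨w, hw, rfl⟩
    have hi : DifferentiableOn ℂ (fun w : Cn n => 1 + inner ℂ a w) (ball 0 1) :=
      ((innerSL ℂ a).differentiable.const_add 1).differentiableOn
    exact (hf.comp hd hmaps).mul
      ((hi.inv fun w hw => one_add_inner_ne_zero ha1 (hwn w hw)).pow (n + 1))
  have hF0 : F 0 = f x := by
    simp only [hF, ballAut_zero, inner_zero_right, add_zero, inv_one, one_pow, mul_one]
    rw [ha, ballCoord, smul_smul, mul_inv_cancel₀ hR.ne', one_smul, add_sub_cancel]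
  rw [himg] at hcv
  rw [hcv, setIntegral_congr_fun measurableSet_ball hpt, integral_const_mul,
    setIntegral_unitBall_eq hFd hFint, hF0, volume_real_unitBall hn, BergmanSpace.normConst,
    ← mul_assoc, ← mul_assoc, ← Complex.ofReal_mul, ← Complex.ofReal_mul]
  have : (n.factorial : ℝ) / Real.pi ^ n / R ^ (2 * n) * R ^ (2 * n) *
      (Real.pi ^ n / n.factorial) = 1 := by
    have := Real.pi_ne_zero
    field_simp
  rw [this, Complex.ofReal_one, one_mul]

/-! ### Differentiation of kernel integrals -/

instance isFiniteMeasure_restrict_ball_Cn {n : ℕ} (ω : Cn n) (R : ℝ) :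
    IsFiniteMeasure ((volume : Measure (Cn n)).restrict (ball ω R)) :=
  isFiniteMeasure_restrict.2 measure_ball_lt_top.ne

theorem ballCoord_add {n : ℕ} (ω : Cn n) (R : ℝ) (x v : Cn n) :
    ballCoord ω R (x + v) = ballCoord ω R x + R⁻¹ • v := by
  simp only [ballCoord]
  module

theorem continuous_ballCoord {n : ℕ} (ω : Cn n) (R : ℝ) : Continuous (ballCoord ω R) := by
  unfold ballCoord
  fun_prop

theorem conj_ballKernel {n : ℕ} (ω : Cn n) (R : ℝ) (z x : Cn n) :
    conj (ballKernel ω R z x) = ballKernel ω R x z := by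
  rw [ballKernel, ballKernel, map_inv₀, map_sub, map_one, inner_conj_symm]

theorem norm_ballKernel_le {n : ℕ} {ω : Cn n} {R : ℝ} {z x : Cn n} {ρ : ℝ}
    (hz : ‖ballCoord ω R z‖ ≤ 1) (hx : ‖ballCoord ω R x‖ ≤ ρ) (hρ : ρ < 1) :
    ‖ballKernel ω R z x‖ ≤ (1 - ρ)⁻¹ := by
  rw [ballKernel, norm_inv]
  refine inv_anti₀ (by linarith) ?_
  have h1 : ‖inner ℂ (ballCoord ω R z) (ballCoord ω R x)‖ ≤ ρ :=
    (norm_inner_le_norm _ _).trans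
      ((mul_le_of_le_one_left (norm_nonneg _) hz).trans hx)
  have h2 := norm_sub_norm_le (1 : ℂ) (inner ℂ (ballCoord ω R z) (ballCoord ω R x))
  rw [norm_one] at h2
  linarith

theorem continuousOn_ballKernel_left {n : ℕ} {ω : Cn n} {R : ℝ} (hR : 0 < R) {x : Cn n}
    (hx : x ∈ ball ω R) : ContinuousOn (fun z => ballKernel ω R z x) (ball ω R) := by
  have := continuous_ballCoord ω R
  refine ContinuousOn.inv₀ (by fun_prop) fun z hz => ?_
  exact one_sub_inner_ne_zero ((norm_ballCoord_lt_one hR).2 hz)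
    ((norm_ballCoord_lt_one hR).2 hx).le

theorem norm_inner_ballCoord_le {n : ℕ} {ω : Cn n} {R : ℝ} (hR : 0 < R) {z : Cn n}
    (hz : ‖ballCoord ω R z‖ ≤ 1) (v : Cn n) :
    ‖inner ℂ (ballCoord ω R z) (R⁻¹ • v)‖ ≤ ‖v‖ / R := by
  refine (norm_inner_le_norm _ _).trans ((mul_le_of_le_one_left (norm_nonneg _) hz).trans ?_)
  rw [norm_smul, Real.norm_of_nonneg (inv_nonneg.2 hR.le), inv_mul_eq_div]

/-- The integrand `⟪(z - ω) / R, v / R⟫ⁱ K(z, x)ʲ`, with `K = ballKernel`: up to a constant, the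
`i`-th derivative in the direction `v` of the power `K(z, ·)^(j - i)` at `x`. -/
def kernelMonomial {n : ℕ} (ω : Cn n) (R : ℝ) (x v : Cn n) (i j : ℕ) (z : Cn n) : ℂ :=
  inner ℂ (ballCoord ω R z) (R⁻¹ • v) ^ i * ballKernel ω R z x ^ j

theorem norm_kernelMonomial_le {n : ℕ} {ω : Cn n} {R : ℝ} (hR : 0 < R) {x z : Cn n} {ρ : ℝ}
    (hz : z ∈ ball ω R) (hx : ‖ballCoord ω R x‖ ≤ ρ) (hρ : ρ < 1) (v : Cn n) (i j : ℕ) :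
    ‖kernelMonomial ω R x v i j z‖ ≤ (‖v‖ / R) ^ i * (1 - ρ)⁻¹ ^ j := by
  have hz1 := ((norm_ballCoord_lt_one hR).2 hz).le
  have h0 : 0 < 1 - ρ := by linarith
  rw [kernelMonomial, norm_mul, norm_pow, norm_pow]
  gcongr
  · exact norm_inner_ballCoord_le hR hz1 v
  · exact norm_ballKernel_le hz1 hx hρ

theorem continuousOn_kernelMonomial {n : ℕ} {ω : Cn n} {R : ℝ} (hR : 0 < R) {x : Cn n}
    (hx : x ∈ ball ω R) (v : Cn n) (i j : ℕ) :
    ContinuousOn (kernelMonomial ω R x v i j) (ball ω R) := by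
  have h1 := continuous_ballCoord ω R
  have h2 := continuousOn_ballKernel_left hR hx
  exact (by fun_prop : Continuous fun z => inner ℂ (ballCoord ω R z) (R⁻¹ • v) ^ i).continuousOn.mul
    (h2.pow j)

theorem integrableOn_kernelMonomial_mul {n : ℕ} {ω : Cn n} {R : ℝ} (hR : 0 < R) {f : Cn n → ℂ}
    (hf : IntegrableOn f (ball ω R)) {x : Cn n} (hx : x ∈ ball ω R) (v : Cn n) (i j : ℕ) :
    IntegrableOn (fun z => kernelMonomial ω R x v i j z * f z) (ball ω R) := by
  refine hf.bdd_mul (c := (‖v‖ / R) ^ i * (1 - ‖ballCoord ω R x‖)⁻¹ ^ j)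
    ((continuousOn_kernelMonomial hR hx v i j).aestronglyMeasurable measurableSet_ball) ?_
  filter_upwards [ae_restrict_mem measurableSet_ball] with z hz
  exact norm_kernelMonomial_le hR hz le_rfl ((norm_ballCoord_lt_one hR).2 hx) v i j

theorem hasDerivAt_kernelMonomial {n : ℕ} {ω : Cn n} {R : ℝ} (hR : 0 < R) {x v z : Cn n} {t : ℝ}
    (hz : z ∈ ball ω R) (hx : x + t • v ∈ ball ω R) (i j : ℕ) :
    HasDerivAt (fun t : ℝ => kernelMonomial ω R (x + t • v) v i j z)
      (j * kernelMonomial ω R (x + t • v) v (i + 1) (j + 1) z) t := by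
  have h1 : ∀ t : ℝ, inner ℂ (ballCoord ω R z) (ballCoord ω R (x + t • v)) =
      inner ℂ (ballCoord ω R z) (ballCoord ω R x) +
        t * inner ℂ (ballCoord ω R z) (R⁻¹ • v) := fun t => by
    rw [ballCoord_add, inner_add_right, smul_comm, ← Complex.coe_smul t, inner_smul_right]
  have hne := one_sub_inner_ne_zero ((norm_ballCoord_lt_one hR).2 hz)
    ((norm_ballCoord_lt_one hR).2 hx).le
  have h2 : HasDerivAt (fun t : ℝ => 1 - inner ℂ (ballCoord ω R z) (ballCoord ω R (x + t • v)))
      (-inner ℂ (ballCoord ω R z) (R⁻¹ • v)) t := by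
    simp only [h1]
    have := (((hasDerivAt_id t).ofReal_comp.mul_const
      (inner ℂ (ballCoord ω R z) (R⁻¹ • v))).const_add
        (inner ℂ (ballCoord ω R z) (ballCoord ω R x))).const_sub 1
    simpa using this
  have h3 := ((h2.fun_inv hne).fun_pow j).const_mul (inner ℂ (ballCoord ω R z) (R⁻¹ • v) ^ i)
  refine h3.congr_deriv ?_
  rw [kernelMonomial, ballKernel]
  rcases j with _ | j
  · simp
  · rw [Nat.add_sub_cancel, div_eq_mul_inv, ← inv_pow]
    ring

theorem continuous_add_smul {n : ℕ} (x v : Cn n) : Continuous fun t : ℝ => x + t • v := by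
  fun_prop

/-- The weighted integral of `f` against a kernel monomial. -/
def kernelPairing {n : ℕ} (ω : Cn n) (R : ℝ) (f : Cn n → ℂ) (v : Cn n) (i j : ℕ) (x : Cn n) : ℂ :=
  BergmanSpace.normConst n R * ∫ z in ball ω R, kernelMonomial ω R x v i j z * f z

/-- Differentiation of a kernel pairing under the integral sign. -/
theorem hasDerivAt_kernelPairing {n : ℕ} {ω : Cn n} {R : ℝ} (hR : 0 < R) {f : Cn n → ℂ}
    (hf : IntegrableOn f (ball ω R)) {x v : Cn n} {t : ℝ} (hx : x + t • v ∈ ball ω R) (i j : ℕ) :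
    HasDerivAt (fun t : ℝ => kernelPairing ω R f v i j (x + t • v))
      (j * kernelPairing ω R f v (i + 1) (j + 1) (x + t • v)) t := by
  obtain ⟨ρ, hρ0, hρ1⟩ := exists_between ((norm_ballCoord_lt_one hR).2 hx)
  set S : Set ℝ := {t | ‖ballCoord ω R (x + t • v)‖ < ρ} with hS
  have hcont := (continuous_ballCoord ω R).comp (continuous_add_smul x v)
  have hSo : S ∈ 𝓝 t := (isOpen_lt hcont.norm continuous_const).mem_nhds hρ0
  have hSb : ∀ u ∈ S, x + u • v ∈ ball ω R := fun u hu =>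
    (norm_ballCoord_lt_one hR).1 (lt_trans hu hρ1)
  have h := (hasDerivAt_integral_of_dominated_loc_of_deriv_le
    (μ := volume.restrict (ball ω R)) (𝕜 := ℝ) (x₀ := t) (s := S)
    (F := fun t z => kernelMonomial ω R (x + t • v) v i j z * f z)
    (F' := fun t z => (j * kernelMonomial ω R (x + t • v) v (i + 1) (j + 1) z) * f z)
    (bound := fun z => (j * ((‖v‖ / R) ^ (i + 1) * (1 - ρ)⁻¹ ^ (j + 1))) * ‖f z‖)
    hSo ?_ ?_ ?_ ?_ ?_ ?_).2
  · have h2 := h.const_mul (BergmanSpace.normConst n R : ℂ)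
    refine h2.congr_deriv ?_
    simp only [kernelPairing, mul_assoc]
    rw [integral_const_mul, mul_left_comm]
  · filter_upwards [hSo] with u hu
    exact (integrableOn_kernelMonomial_mul hR hf (hSb u hu) v i j).aestronglyMeasurable
  · exact integrableOn_kernelMonomial_mul hR hf hx v i j
  · have := (integrableOn_kernelMonomial_mul hR hf hx v (i + 1) (j + 1)).const_mul (j : ℂ)
    simp only [mul_assoc]
    exact this.aestronglyMeasurable
  · filter_upwards [ae_restrict_mem measurableSet_ball] with z hz u hu
    rw [norm_mul, norm_mul, Complex.norm_natCast]
    gcongr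
    exact norm_kernelMonomial_le hR hz (le_of_lt hu) hρ1 v (i + 1) (j + 1)
  · exact hf.norm.const_mul _
  · filter_upwards [ae_restrict_mem measurableSet_ball] with z hz u hu
    exact (hasDerivAt_kernelMonomial hR hz (hSb u hu) i j).mul_const (f z)

namespace BergmanSpace

variable {n : ℕ} {ω : Cn n} {R : ℝ}

theorem integrableOn (f : BergmanSpace ω R) : IntegrableOn f (ball ω R) :=
  f.2.2.1.integrable one_le_two

theorem differentiableOn (f : BergmanSpace ω R) : DifferentiableOn ℂ f (ball ω R) :=
  f.2.1.differentiableOn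

/-- The reproducing property of the Bergman kernel. -/
theorem kernelPairing_eq_apply (hn : 1 ≤ n) (hR : 0 < R) (f : BergmanSpace ω R) (v : Cn n)
    {x : Cn n} (hx : x ∈ ball ω R) : kernelPairing ω R f v 0 (n + 1) x = f x := by
  have h := integrableOn_kernelMonomial_mul hR f.integrableOn hx v 0 (n + 1)
  simp only [kernelMonomial, pow_zero, one_mul] at h
  simp only [kernelPairing, kernelMonomial, pow_zero, one_mul]
  exact bergman_reproducing hn hR f.differentiableOn hx h

/-- The conjugate of a kernel monomial, as an element of the Bergman space. It is extended by `0`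
outside the ball, as all elements are. -/
def kernel (hR : 0 < R) {x : Cn n} (hx : x ∈ ball ω R) (v : Cn n) (i j : ℕ) :
    BergmanSpace ω R :=
  ⟨(ball ω R).indicator fun z =>
      inner ℂ (R⁻¹ • v) (ballCoord ω R z) ^ i * ballKernel ω R x z ^ j, by
    have hcoord : ∀ z, AnalyticAt ℂ (ballCoord ω R) z := fun z => by
      have : ballCoord ω R = fun z => (R⁻¹ : ℂ) • (z - ω) := by
        funext z
        rw [ballCoord, ← Complex.coe_smul, Complex.ofReal_inv]
      rw [this]
      fun_prop
    have hinner : ∀ a z, AnalyticAt ℂ (fun z => inner ℂ a (ballCoord ω R z)) z := fun a z =>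
      ((innerSL ℂ a).analyticAt _).comp (hcoord z)
    have hana : AnalyticOnNhd ℂ
        (fun z => inner ℂ (R⁻¹ • v) (ballCoord ω R z) ^ i * ballKernel ω R x z ^ j)
        (ball ω R) := fun z hz =>
      ((hinner _ z).pow i).mul (((analyticAt_const.sub (hinner _ z)).inv
        (one_sub_inner_ne_zero ((norm_ballCoord_lt_one hR).2 hx)
          ((norm_ballCoord_lt_one hR).2 hz).le)).pow j)
    have heq : ∀ z ∈ ball ω R, (ball ω R).indicator
        (fun z => inner ℂ (R⁻¹ • v) (ballCoord ω R z) ^ i * ballKernel ω R x z ^ j) z =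
        inner ℂ (R⁻¹ • v) (ballCoord ω R z) ^ i * ballKernel ω R x z ^ j := fun z hz =>
      Set.indicator_of_mem hz _
    refine ⟨fun z hz => (hana z hz).congr ?_, ?_, fun z hz => Set.indicator_of_notMem hz _⟩
    · filter_upwards [isOpen_ball.mem_nhds hz] with w hw using (heq w hw).symm
    · refine (memLp_indicator_iff_restrict measurableSet_ball).2 ?_ |>.restrict _
      refine MemLp.of_bound (hana.continuousOn.aestronglyMeasurable measurableSet_ball)
        ((‖v‖ / R) ^ i * (1 - ‖ballCoord ω R x‖)⁻¹ ^ j) ?_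
      filter_upwards [ae_restrict_mem measurableSet_ball] with z hz
      have h := norm_kernelMonomial_le hR hz le_rfl ((norm_ballCoord_lt_one hR).2 hx) v i j
      rwa [kernelMonomial, ← Complex.norm_conj, map_mul, map_pow, map_pow, inner_conj_symm,
        conj_ballKernel] at h⟩

theorem kernel_apply (hR : 0 < R) {x : Cn n} (hx : x ∈ ball ω R) (v : Cn n) (i j : ℕ) {z : Cn n}
    (hz : z ∈ ball ω R) : kernel hR hx v i j z =
      inner ℂ (R⁻¹ • v) (ballCoord ω R z) ^ i * ballKernel ω R x z ^ j :=
  Set.indicator_of_mem hz fun z =>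
    inner ℂ (R⁻¹ • v) (ballCoord ω R z) ^ i * ballKernel ω R x z ^ j

theorem conj_kernel_apply (hR : 0 < R) {x : Cn n} (hx : x ∈ ball ω R) (v : Cn n) (i j : ℕ)
    {z : Cn n} (hz : z ∈ ball ω R) :
    conj (kernel hR hx v i j z) = kernelMonomial ω R x v i j z := by
  rw [kernel_apply hR hx v i j hz, map_mul, map_pow, map_pow, inner_conj_symm, conj_ballKernel,
    kernelMonomial]

theorem inner_kernel (hR : 0 < R) {x : Cn n} (hx : x ∈ ball ω R) (v : Cn n) (i j : ℕ)
    (f : BergmanSpace ω R) :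
    inner ℂ (kernel hR hx v i j) f = kernelPairing ω R f v i j x := by
  rw [inner_def, kernelPairing]
  congr 1
  exact setIntegral_congr_fun measurableSet_ball fun z hz => by
    simp only [conj_kernel_apply hR hx v i j hz]

/-- First directional derivatives as kernel pairings. -/
theorem hasDerivAt_line (hn : 1 ≤ n) (hR : 0 < R) (f : BergmanSpace ω R) {x v : Cn n} {t : ℝ}
    (hx : x + t • v ∈ ball ω R) :
    HasDerivAt (fun t : ℝ => f (x + t • v))
      ((n + 1) * kernelPairing ω R f v 1 (n + 2) (x + t • v)) t := by
  have h := hasDerivAt_kernelPairing hR f.integrableOn hx 0 (n + 1)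
  push_cast at h
  refine h.congr_of_eventuallyEq ?_
  filter_upwards [(continuous_add_smul x v).continuousAt.preimage_mem_nhds
    (isOpen_ball.mem_nhds hx)] with u hu
  exact (kernelPairing_eq_apply hn hR f v hu).symm

end BergmanSpace

/-! ### Norms of the kernels representing directional derivatives -/

/-- The quantity `1 - ν_x²`, which measures the distance from `x` to the boundary of the ball. -/
def ballDefect {n : ℕ} (ω : Cn n) (R : ℝ) (x : Cn n) : ℝ := 1 - ‖ballCoord ω R x‖ ^ 2

theorem ballDefect_pos {n : ℕ} {ω : Cn n} {R : ℝ} (hR : 0 < R) {x : Cn n} (hx : x ∈ ball ω R) :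
    0 < ballDefect ω R x :=
  one_sub_norm_sq_pos ((norm_ballCoord_lt_one hR).2 hx)

theorem hasDerivAt_affine_pow_mul_inv_pow (y p q d : ℂ) (i j : ℕ) {t : ℝ} (h : d - t * p ≠ 0) :
    HasDerivAt (fun t : ℝ => (y + t * q) ^ (i + 1) * (d - t * p)⁻¹ ^ j)
      ((i + 1) * q * (y + t * q) ^ i * (d - t * p)⁻¹ ^ j +
        j * p * (y + t * q) ^ (i + 1) * (d - t * p)⁻¹ ^ (j + 1)) t := by
  have h1 : HasDerivAt (fun t : ℝ => y + t * q) q t := by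
    simpa using ((hasDerivAt_id t).ofReal_comp.mul_const q).const_add y
  have h2 : HasDerivAt (fun t : ℝ => d - t * p) (-p) t := by
    simpa using ((hasDerivAt_id t).ofReal_comp.mul_const p).const_sub d
  refine ((h1.fun_pow (i + 1)).mul ((h2.fun_inv h).fun_pow j)).congr_deriv ?_
  rcases j with _ | j
  · simp
    ring
  · rw [Nat.add_sub_cancel, Nat.add_sub_cancel, div_eq_mul_inv, ← inv_pow]
    push_cast
    ring

namespace BergmanSpace

variable {n : ℕ} {ω : Cn n} {R : ℝ}

/-- A representing kernel along the line through `x` in the direction `v`. -/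
theorem kernel_apply_line (hR : 0 < R) {x v : Cn n} (hx : x ∈ ball ω R) (i j : ℕ) {t : ℝ}
    (ht : x + t • v ∈ ball ω R) :
    (ballDefect ω R x : ℂ) - t * conj (inner ℂ (R⁻¹ • v) (ballCoord ω R x)) ≠ 0 ∧
    kernel hR hx v i j (x + t • v) =
      (inner ℂ (R⁻¹ • v) (ballCoord ω R x) + t * ((‖R⁻¹ • v‖ ^ 2 : ℝ) : ℂ)) ^ i *
      (ballDefect ω R x - t * conj (inner ℂ (R⁻¹ • v) (ballCoord ω R x)))⁻¹ ^ j := by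
  have h1 : (ballDefect ω R x : ℂ) - t * conj (inner ℂ (R⁻¹ • v) (ballCoord ω R x)) =
      1 - inner ℂ (ballCoord ω R x) (ballCoord ω R (x + t • v)) := by
    rw [ballCoord_add, inner_add_right, smul_comm, ← Complex.coe_smul t, inner_smul_right,
      inner_self_eq_norm_sq_to_K, inner_conj_symm, ballDefect]
    push_cast
    exact sub_sub _ _ _
  have h2 : inner ℂ (R⁻¹ • v) (ballCoord ω R x) + t * ((‖R⁻¹ • v‖ ^ 2 : ℝ) : ℂ) =
      inner ℂ (R⁻¹ • v) (ballCoord ω R (x + t • v)) := by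
    rw [ballCoord_add, inner_add_right, smul_comm, ← Complex.coe_smul t, inner_smul_right,
      inner_self_eq_norm_sq_to_K]
    push_cast
    rfl
  refine ⟨?_, ?_⟩
  · rw [h1]
    exact one_sub_inner_ne_zero ((norm_ballCoord_lt_one hR).2 hx)
      ((norm_ballCoord_lt_one hR).2 ht).le
  · rw [kernel_apply hR hx v i j ht, h1, h2, ballKernel]

theorem eventually_add_smul_mem_ball {x : Cn n} (v : Cn n) {t : ℝ} (hx : x + t • v ∈ ball ω R) :
    ∀ᶠ u : ℝ in 𝓝 t, x + u • v ∈ ball ω R :=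
  (continuous_add_smul x v).continuousAt.preimage_mem_nhds (isOpen_ball.mem_nhds hx)

theorem norm_sq_kernel (hR : 0 < R) {x : Cn n} (hx : x ∈ ball ω R) (v : Cn n) (i j : ℕ) :
    ((‖kernel hR hx v i j‖ ^ 2 : ℝ) : ℂ) = kernelPairing ω R (kernel hR hx v i j) v i j x := by
  rw [← inner_kernel hR hx, inner_self_eq_norm_sq_to_K]
  push_cast
  rfl

theorem norm_kernelPairing_sq_le (hR : 0 < R) {x : Cn n} (hx : x ∈ ball ω R) (v : Cn n) (i j : ℕ)
    (f : BergmanSpace ω R) :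
    ‖kernelPairing ω R f v i j x‖ ^ 2 ≤ ‖kernel hR hx v i j‖ ^ 2 * ‖f‖ ^ 2 := by
  rw [← inner_kernel hR hx, ← mul_pow]
  gcongr
  exact norm_inner_le_norm _ _

/-- The norm of the Bergman kernel at `x`. -/
theorem norm_sq_kernel_zero (hn : 1 ≤ n) (hR : 0 < R) {x : Cn n} (hx : x ∈ ball ω R) (v : Cn n) :
    ‖kernel hR hx v 0 (n + 1)‖ ^ 2 = (ballDefect ω R x)⁻¹ ^ (n + 1) := by
  have h := norm_sq_kernel hR hx v 0 (n + 1)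
  have hx0 : x + (0 : ℝ) • v ∈ ball ω R := by simpa using hx
  have h1 := (kernel_apply_line hR hx 0 (n + 1) hx0).2
  rw [zero_smul, add_zero, pow_zero, one_mul, Complex.ofReal_zero, zero_mul, sub_zero] at h1
  rw [kernelPairing_eq_apply hn hR _ v hx, h1] at h
  exact_mod_cast h

/-- The norm of the representing kernel of a first derivative, obtained by applying the functional
to its own representing kernel. -/
theorem norm_sq_kernel_one (hn : 1 ≤ n) (hR : 0 < R) {x : Cn n} (hx : x ∈ ball ω R) (v : Cn n) :
    (n + 1) * ‖kernel hR hx v 1 (n + 2)‖ ^ 2 =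
      ‖R⁻¹ • v‖ ^ 2 * (ballDefect ω R x)⁻¹ ^ (n + 2) +
      (n + 2) * ‖(inner ℂ (R⁻¹ • v) (ballCoord ω R x) : ℂ)‖ ^ 2 *
        (ballDefect ω R x)⁻¹ ^ (n + 3) := by
  have hx0 : x + (0 : ℝ) • v ∈ ball ω R := by simpa using hx
  have h1 := hasDerivAt_line hn hR (kernel hR hx v 1 (n + 2)) hx0
  have h2 := hasDerivAt_affine_pow_mul_inv_pow (inner ℂ (R⁻¹ • v) (ballCoord ω R x))
    (conj (inner ℂ (R⁻¹ • v) (ballCoord ω R x))) ((‖R⁻¹ • v‖ ^ 2 : ℝ) : ℂ) (ballDefect ω R x)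
    0 (n + 2) (kernel_apply_line hR hx 1 (n + 2) hx0).1
  have h3 := (h1.congr_of_eventuallyEq (f₁ := _) (by
    filter_upwards [eventually_add_smul_mem_ball v hx0] with u hu
    exact (kernel_apply_line hR hx 1 (n + 2) hu).2.symm)).unique h2
  have h4 : ∀ a : ℂ, conj a * a = ((‖a‖ ^ 2 : ℝ) : ℂ) := fun a => by
    rw [mul_comm, Complex.mul_conj, Complex.normSq_eq_norm_sq]
  have h5 := norm_sq_kernel hR hx v 1 (n + 2)
  rw [zero_smul, add_zero, ← h5] at h3
  simp only [Complex.ofReal_zero, zero_mul, sub_zero, add_zero, zero_add, pow_zero, pow_one,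
    mul_one, one_mul, Nat.cast_zero] at h3
  rw [mul_assoc ((n + 2 : ℕ) : ℂ), h4] at h3
  have h6 : (((n + 1) * ‖kernel hR hx v 1 (n + 2)‖ ^ 2 : ℝ) : ℂ) =
      ((‖R⁻¹ • v‖ ^ 2 * (ballDefect ω R x)⁻¹ ^ (n + 2) +
      (n + 2) * ‖(inner ℂ (R⁻¹ • v) (ballCoord ω R x) : ℂ)‖ ^ 2 *
        (ballDefect ω R x)⁻¹ ^ (n + 3) : ℝ) : ℂ) := by
    push_cast at h3 ⊢
    exact h3
  exact_mod_cast h6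

/-- The norm of the representing kernel of a second derivative, obtained by applying the functional
to its own representing kernel. -/
theorem norm_sq_kernel_two (hn : 1 ≤ n) (hR : 0 < R) {x : Cn n} (hx : x ∈ ball ω R) (v : Cn n) :
    (n + 1) * (n + 2) * ‖kernel hR hx v 2 (n + 3)‖ ^ 2 =
      2 * (‖R⁻¹ • v‖ ^ 2) ^ 2 * (ballDefect ω R x)⁻¹ ^ (n + 3) +
      4 * (n + 3) * ‖R⁻¹ • v‖ ^ 2 * ‖(inner ℂ (R⁻¹ • v) (ballCoord ω R x) : ℂ)‖ ^ 2 *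
        (ballDefect ω R x)⁻¹ ^ (n + 4) +
      (n + 3) * (n + 4) * (‖(inner ℂ (R⁻¹ • v) (ballCoord ω R x) : ℂ)‖ ^ 2) ^ 2 *
        (ballDefect ω R x)⁻¹ ^ (n + 5) := by
  set κ := kernel hR hx v 2 (n + 3) with hκ
  set y : ℂ := inner ℂ (R⁻¹ • v) (ballCoord ω R x) with hy
  set d : ℂ := (ballDefect ω R x : ℂ) with hd
  set q : ℂ := ((‖R⁻¹ • v‖ ^ 2 : ℝ) : ℂ) with hq
  have hx0 : x + (0 : ℝ) • v ∈ ball ω R := by simpa using hx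
  have hfirst : ∀ t : ℝ, x + t • v ∈ ball ω R →
      (n + 1) * kernelPairing ω R κ v 1 (n + 2) (x + t • v) =
        2 * q * ((y + t * q) ^ (0 + 1) * (d - t * conj y)⁻¹ ^ (n + 3)) +
        (n + 3) * conj y * ((y + t * q) ^ (1 + 1) * (d - t * conj y)⁻¹ ^ (n + 4)) := fun t ht => by
    have h1 := hasDerivAt_line hn hR κ ht
    have h2 := hasDerivAt_affine_pow_mul_inv_pow y (conj y) q d 1 (n + 3)
      (kernel_apply_line hR hx 2 (n + 3) ht).1
    rw [(h1.congr_of_eventuallyEq (f₁ := _) (by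
      filter_upwards [eventually_add_smul_mem_ball v ht] with u hu
      exact (kernel_apply_line hR hx 2 (n + 3) hu).2.symm)).unique h2]
    push_cast
    ring
  have hne := (kernel_apply_line hR hx 2 (n + 3) hx0).1
  have h3 := (hasDerivAt_kernelPairing hR κ.integrableOn hx0 1 (n + 2)).const_mul ((n : ℂ) + 1)
  have h4 := ((hasDerivAt_affine_pow_mul_inv_pow y (conj y) q d 0 (n + 3) hne).const_mul
    (2 * q)).add ((hasDerivAt_affine_pow_mul_inv_pow y (conj y) q d 1 (n + 4) hne).const_mul
      ((n + 3) * conj y))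
  have h5 := (h3.congr_of_eventuallyEq (f₁ := _) (by
    filter_upwards [eventually_add_smul_mem_ball v hx0] with u hu
    exact (hfirst u hu).symm)).unique h4
  have h6 : ∀ a : ℂ, ((‖a‖ ^ 2 : ℝ) : ℂ) = conj a * a := fun a => by
    rw [mul_comm, Complex.mul_conj, Complex.normSq_eq_norm_sq]
  have h7 : ((‖κ‖ ^ 2 : ℝ) : ℂ) = kernelPairing ω R κ v 2 (n + 3) x :=
    norm_sq_kernel hR hx v 2 (n + 3)
  rw [zero_smul, add_zero] at h5
  have h8 : (((n + 1) * (n + 2) * ‖κ‖ ^ 2 : ℝ) : ℂ) =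
      ((2 * (‖R⁻¹ • v‖ ^ 2) ^ 2 * (ballDefect ω R x)⁻¹ ^ (n + 3) +
      4 * (n + 3) * ‖R⁻¹ • v‖ ^ 2 * ‖y‖ ^ 2 * (ballDefect ω R x)⁻¹ ^ (n + 4) +
      (n + 3) * (n + 4) * (‖y‖ ^ 2) ^ 2 * (ballDefect ω R x)⁻¹ ^ (n + 5) : ℝ) : ℂ) := by
    have h9 : (((n + 1) * (n + 2) * ‖κ‖ ^ 2 : ℝ) : ℂ) =
        (n + 1) * (n + 2) * ((‖κ‖ ^ 2 : ℝ) : ℂ) := by push_cast; rfl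
    have h10 : ((2 * (‖R⁻¹ • v‖ ^ 2) ^ 2 * (ballDefect ω R x)⁻¹ ^ (n + 3) +
      4 * (n + 3) * ‖R⁻¹ • v‖ ^ 2 * ‖y‖ ^ 2 * (ballDefect ω R x)⁻¹ ^ (n + 4) +
      (n + 3) * (n + 4) * (‖y‖ ^ 2) ^ 2 * (ballDefect ω R x)⁻¹ ^ (n + 5) : ℝ) : ℂ) =
      2 * q ^ 2 * d⁻¹ ^ (n + 3) + 4 * (n + 3) * q * ((‖y‖ ^ 2 : ℝ) : ℂ) * d⁻¹ ^ (n + 4) +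
      (n + 3) * (n + 4) * ((‖y‖ ^ 2 : ℝ) : ℂ) ^ 2 * d⁻¹ ^ (n + 5) := by
      rw [hq, hd]
      push_cast
      rfl
    rw [h9, h10, h6, h7]
    simp only [Complex.ofReal_zero, zero_mul, sub_zero, add_zero] at h5
    push_cast at h5
    linear_combination h5
  exact_mod_cast h8

theorem norm_inner_sq_le (x v : Cn n) :
    ‖(inner ℂ (R⁻¹ • v) (ballCoord ω R x) : ℂ)‖ ^ 2 ≤
      ‖R⁻¹ • v‖ ^ 2 * (1 - ballDefect ω R x) := by
  rw [ballDefect, sub_sub_cancel, ← mul_pow]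
  gcongr
  exact norm_inner_le_norm _ _

/-- A bound for a first directional derivative. -/
theorem norm_deriv_le (hn : 1 ≤ n) (hR : 0 < R) {x : Cn n} (hx : x ∈ ball ω R) (v : Cn n)
    (f : BergmanSpace ω R) :
    ‖(n + 1) * kernelPairing ω R f v 1 (n + 2) x‖ ^ 2 ≤
      (n + 1) * (n + 2) * ‖R⁻¹ • v‖ ^ 2 * (ballDefect ω R x)⁻¹ ^ (n + 3) * ‖f‖ ^ 2 := by
  have hd := ballDefect_pos hR hx
  have h1 := norm_kernelPairing_sq_le hR hx v 1 (n + 2) f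
  have h2 := norm_sq_kernel_one hn hR hx v
  have h3 := norm_inner_sq_le (ω := ω) (R := R) x v
  set d := ballDefect ω R x
  set q := ‖R⁻¹ • v‖ ^ 2
  set Y := ‖(inner ℂ (R⁻¹ • v) (ballCoord ω R x) : ℂ)‖ ^ 2
  have hq : 0 ≤ q := by positivity
  have h4 : q * d⁻¹ ^ (n + 2) + (n + 2) * Y * d⁻¹ ^ (n + 3) ≤
      (n + 2) * q * d⁻¹ ^ (n + 3) := by
    have h5 : q * d⁻¹ ^ (n + 2) = (q * d) * d⁻¹ ^ (n + 3) := by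
      rw [pow_succ _ (n + 2)]
      field_simp
    rw [h5, ← add_mul]
    gcongr
    have h6 : 0 ≤ q * d * (n + 1) := by positivity
    nlinarith [mul_le_mul_of_nonneg_left h3 (by positivity : (0 : ℝ) ≤ n + 2)]
  have h7 : ‖(n + 1 : ℂ)‖ = n + 1 := by
    exact_mod_cast Complex.norm_natCast (n + 1)
  rw [norm_mul, mul_pow, h7]
  calc ((n : ℝ) + 1) ^ 2 * ‖kernelPairing ω R f v 1 (n + 2) x‖ ^ 2
      ≤ (n + 1) ^ 2 * (‖kernel hR hx v 1 (n + 2)‖ ^ 2 * ‖f‖ ^ 2) := by gcongr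
    _ = (n + 1) * ((n + 1) * ‖kernel hR hx v 1 (n + 2)‖ ^ 2) * ‖f‖ ^ 2 := by ring
    _ ≤ (n + 1) * ((n + 2) * q * d⁻¹ ^ (n + 3)) * ‖f‖ ^ 2 := by
        rw [h2]
        gcongr
    _ = _ := by ring

/-- A bound for a second directional derivative. -/
theorem norm_deriv_two_le (hn : 1 ≤ n) (hR : 0 < R) {x : Cn n} (hx : x ∈ ball ω R) (v : Cn n)
    (f : BergmanSpace ω R) :
    ‖(n + 1) * ((n + 2) * kernelPairing ω R f v 2 (n + 3) x)‖ ^ 2 ≤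
      (n + 1) * (n + 2) * ((n + 3) * (n + 4)) * (‖R⁻¹ • v‖ ^ 2) ^ 2 *
        (ballDefect ω R x)⁻¹ ^ (n + 5) * ‖f‖ ^ 2 := by
  have hd := ballDefect_pos hR hx
  have h1 := norm_kernelPairing_sq_le hR hx v 2 (n + 3) f
  have h2 := norm_sq_kernel_two hn hR hx v
  have h3 := norm_inner_sq_le (ω := ω) (R := R) x v
  set d := ballDefect ω R x
  set q := ‖R⁻¹ • v‖ ^ 2
  set Y := ‖(inner ℂ (R⁻¹ • v) (ballCoord ω R x) : ℂ)‖ ^ 2 with hY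
  have hq : 0 ≤ q := by positivity
  have hY0 : 0 ≤ Y := by positivity
  have h4 : 2 * q ^ 2 * d⁻¹ ^ (n + 3) + 4 * (n + 3) * q * Y * d⁻¹ ^ (n + 4) +
      (n + 3) * (n + 4) * Y ^ 2 * d⁻¹ ^ (n + 5) ≤
      (n + 3) * (n + 4) * q ^ 2 * d⁻¹ ^ (n + 5) := by
    have h5 : 2 * q ^ 2 * d⁻¹ ^ (n + 3) + 4 * (n + 3) * q * Y * d⁻¹ ^ (n + 4) +
        (n + 3) * (n + 4) * Y ^ 2 * d⁻¹ ^ (n + 5) =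
        (2 * (q * d) ^ 2 + 4 * (n + 3) * (q * d) * Y + (n + 3) * (n + 4) * Y ^ 2) *
          d⁻¹ ^ (n + 5) := by
      rw [pow_succ _ (n + 4), pow_succ _ (n + 3)]
      field_simp
    rw [h5]
    gcongr
    -- compare with `(n + 3) (n + 4) (q d + Y)²`, where `q d + Y ≤ q`
    have h6 : q * d + Y ≤ q := by linarith
    have h7 : (q * d + Y) ^ 2 ≤ q ^ 2 := by gcongr
    have hn0 : (0 : ℝ) ≤ n := n.cast_nonneg
    have h8 : 0 ≤ q * d * Y := by positivity
    nlinarith [mul_le_mul_of_nonneg_left h7 (by positivity : (0 : ℝ) ≤ (n + 3) * (n + 4)),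
      mul_nonneg (by positivity : (0 : ℝ) ≤ n ^ 2 + 7 * n + 10) (sq_nonneg (q * d)),
      mul_nonneg (by positivity : (0 : ℝ) ≤ 2 * n ^ 2 + 10 * n + 12) h8]
  have h7 : ‖(n + 1 : ℂ)‖ = n + 1 := by
    exact_mod_cast Complex.norm_natCast (n + 1)
  have h8 : ‖(n + 2 : ℂ)‖ = n + 2 := by
    exact_mod_cast Complex.norm_natCast (n + 2)
  rw [norm_mul, norm_mul, mul_pow, mul_pow, h7, h8]
  calc ((n : ℝ) + 1) ^ 2 * ((n + 2) ^ 2 * ‖kernelPairing ω R f v 2 (n + 3) x‖ ^ 2)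
      ≤ (n + 1) ^ 2 * ((n + 2) ^ 2 * (‖kernel hR hx v 2 (n + 3)‖ ^ 2 * ‖f‖ ^ 2)) := by gcongr
    _ = (n + 1) * (n + 2) * ((n + 1) * (n + 2) * ‖kernel hR hx v 2 (n + 3)‖ ^ 2) * ‖f‖ ^ 2 := by
        ring
    _ ≤ (n + 1) * (n + 2) * ((n + 3) * (n + 4) * q ^ 2 * d⁻¹ ^ (n + 5)) * ‖f‖ ^ 2 := by
        rw [h2]
        gcongr
    _ = _ := by ring

end BergmanSpace

/-! ### Taylor estimates in the Bergman space -/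

/-- Taylor's formula of order one on `[0, 1]`, with a bound on the second derivative. -/
theorem norm_taylor_one_le {h h₁ h₂ : ℝ → ℂ} {M : ℝ}
    (hd : ∀ t ∈ Set.Icc (0 : ℝ) 1, HasDerivAt h (h₁ t) t)
    (hd₁ : ∀ t ∈ Set.Icc (0 : ℝ) 1, HasDerivAt h₁ (h₂ t) t)
    (hM : ∀ t ∈ Set.Icc (0 : ℝ) 1, ‖h₂ t‖ ≤ M) : ‖h 1 - h 0 - h₁ 0‖ ≤ M / 2 := by
  have h1 : ∀ t ∈ Set.Icc (0 : ℝ) 1, ‖h₁ t - h₁ 0‖ ≤ M * (t - 0) :=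
    norm_image_sub_le_of_norm_deriv_le_segment' (fun t ht => (hd₁ t ht).hasDerivWithinAt)
      fun t ht => hM t (Set.Ico_subset_Icc_self ht)
  have h2 : ∀ t ∈ Set.Icc (0 : ℝ) 1,
      HasDerivAt (fun t : ℝ => h t - h 0 - t * h₁ 0) (h₁ t - h₁ 0) t := fun t ht => by
    simpa using ((hd t ht).sub_const (h 0)).fun_sub
      ((hasDerivAt_id t).ofReal_comp.mul_const (h₁ 0))
  have h3 : ∀ t : ℝ, HasDerivAt (fun t : ℝ => M / 2 * t ^ 2) (M * (t - 0)) t := fun t => by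
    refine ((hasDerivAt_pow 2 t).const_mul (M / 2)).congr_deriv ?_
    push_cast
    ring
  have h4 := image_norm_le_of_norm_deriv_right_le_deriv_boundary
    (fun t ht => (h2 t ht).continuousAt.continuousWithinAt)
    (fun t ht => (h2 t (Set.Ico_subset_Icc_self ht)).hasDerivWithinAt) (by simp) h3
    (fun t ht => h1 t (Set.Ico_subset_Icc_self ht)) (Set.right_mem_Icc.2 zero_le_one)
  simpa using h4

namespace BergmanSpace

variable {n : ℕ} {ω : Cn n} {R : ℝ}

theorem fderiv_apply_eq (hn : 1 ≤ n) (hR : 0 < R) (f : BergmanSpace ω R) {x : Cn n}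
    (hx : x ∈ ball ω R) (v : Cn n) :
    fderiv ℂ f x v = (n + 1) * kernelPairing ω R f v 1 (n + 2) x := by
  have hx0 : x + (0 : ℝ) • v ∈ ball ω R := by simpa using hx
  have h1 := hasDerivAt_line hn hR f hx0
  have h2 : HasFDerivAt f (fderiv ℂ f x) (x + (0 : ℝ) • v) := by
    rw [zero_smul, add_zero]
    exact (f.2.1 x hx).differentiableAt.hasFDerivAt
  have h3 : HasDerivAt (fun t : ℝ => x + t • v) v 0 := by
    simpa using ((hasDerivAt_id (0 : ℝ)).smul_const v).const_add x
  have h4 := ((h2.restrictScalars ℝ).comp_hasDerivAt (0 : ℝ) h3).unique h1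
  rw [zero_smul, add_zero] at h4
  exact h4

theorem add_smul_mem_ball {x v : Cn n} (hx : x ∈ ball ω R) (hxv : x + v ∈ ball ω R) {t : ℝ}
    (ht : t ∈ Set.Icc (0 : ℝ) 1) : x + t • v ∈ ball ω R := by
  have h := (convex_ball ω R).add_smul_sub_mem hx hxv ht
  rwa [add_sub_cancel_left] at h

/-- An increment of `f` in the ball, where `e²` is a lower bound for `ballDefect` on the
segment. -/
theorem norm_add_sub_le (hn : 2 ≤ n) (hR : 0 < R) (f : BergmanSpace ω R) {x v : Cn n}
    (hx : x ∈ ball ω R) (hxv : x + v ∈ ball ω R) {e : ℝ} (he : 0 < e)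
    (hd : ∀ t ∈ Set.Icc (0 : ℝ) 1, e ^ 2 ≤ ballDefect ω R (x + t • v)) :
    ‖f (x + v) - f x‖ ≤
      3 / 10 * ((n + 1) * (n + 2)) * ‖R⁻¹ • v‖ * e⁻¹ ^ (n + 3) * ‖f‖ := by
  have hmem := fun t ht => add_smul_mem_ball (t := t) hx hxv ht
  have h1 := norm_image_sub_le_of_norm_deriv_le_segment_01' (f := fun t : ℝ => f (x + t • v))
    (C := 3 / 10 * ((n + 1) * (n + 2)) * ‖R⁻¹ • v‖ * e⁻¹ ^ (n + 3) * ‖f‖)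
    (fun t ht => (hasDerivAt_line (by omega) hR f (hmem t ht)).hasDerivWithinAt) fun t ht => ?_
  · simpa using h1
  have ht' := Set.Ico_subset_Icc_self ht
  have h2 := norm_deriv_le (by omega) hR (hmem t ht') v f
  refine le_of_sq_le_sq (h2.trans ?_) (by positivity)
  have h3 : (ballDefect ω R (x + t • v))⁻¹ ≤ e⁻¹ ^ 2 := by
    rw [inv_pow]
    exact inv_anti₀ (by positivity) (hd t ht')
  have h4 := ballDefect_pos hR (hmem t ht')
  have hn' : (2 : ℝ) ≤ n := by exact_mod_cast hn
  have h5 : ((n : ℝ) + 1) * (n + 2) ≤ (3 / 10 * ((n + 1) * (n + 2))) ^ 2 := by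
    have h6 : (12 : ℝ) ≤ (n + 1) * (n + 2) := by nlinarith
    nlinarith
  calc ((n : ℝ) + 1) * (n + 2) * ‖R⁻¹ • v‖ ^ 2 * (ballDefect ω R (x + t • v))⁻¹ ^ (n + 3) * ‖f‖ ^ 2
      ≤ (3 / 10 * ((n + 1) * (n + 2))) ^ 2 * ‖R⁻¹ • v‖ ^ 2 * (e⁻¹ ^ 2) ^ (n + 3) * ‖f‖ ^ 2 := by
        gcongr
    _ = _ := by ring

/-- The quadratic Taylor remainder of `f` in the ball, where `e²` is a lower bound for `ballDefect`
on the segment. -/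
theorem norm_taylor_le (hn : 2 ≤ n) (hR : 0 < R) (f : BergmanSpace ω R) {x v : Cn n}
    (hx : x ∈ ball ω R) (hxv : x + v ∈ ball ω R) {e : ℝ} (he : 0 < e)
    (hd : ∀ t ∈ Set.Icc (0 : ℝ) 1, e ^ 2 ≤ ballDefect ω R (x + t • v)) :
    ‖f (x + v) - f x - fderiv ℂ f x v‖ ≤
      4 / 5 * ((n + 1) * (n + 2)) * ‖R⁻¹ • v‖ ^ 2 * e⁻¹ ^ (n + 5) * ‖f‖ := by
  have hmem := fun t ht => add_smul_mem_ball (t := t) hx hxv ht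
  have h1 := norm_taylor_one_le (h := fun t : ℝ => f (x + t • v))
    (h₁ := fun t => (n + 1) * kernelPairing ω R f v 1 (n + 2) (x + t • v))
    (h₂ := fun t => (n + 1) * ((n + 2) * kernelPairing ω R f v 2 (n + 3) (x + t • v)))
    (M := 8 / 5 * ((n + 1) * (n + 2)) * ‖R⁻¹ • v‖ ^ 2 * e⁻¹ ^ (n + 5) * ‖f‖)
    (fun t ht => hasDerivAt_line (by omega) hR f (hmem t ht)) (fun t ht => ?_) fun t ht => ?_
  · simp only [one_smul, zero_smul, add_zero] at h1
    rw [fderiv_apply_eq (by omega) hR f hx]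
    refine h1.trans_eq ?_
    ring
  · have h2 := (hasDerivAt_kernelPairing hR f.integrableOn (hmem t ht) 1 (n + 2)).const_mul
      ((n : ℂ) + 1)
    push_cast at h2
    exact h2
  have h2 := norm_deriv_two_le (by omega) hR (hmem t ht) v f
  refine le_of_sq_le_sq (h2.trans ?_) (by positivity)
  have h3 : (ballDefect ω R (x + t • v))⁻¹ ≤ e⁻¹ ^ 2 := by
    rw [inv_pow]
    exact inv_anti₀ (by positivity) (hd t ht)
  have h4 := ballDefect_pos hR (hmem t ht)
  have hn' : (2 : ℝ) ≤ n := by exact_mod_cast hn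
  have h5 : ((n : ℝ) + 1) * (n + 2) * ((n + 3) * (n + 4)) ≤ (8 / 5 * ((n + 1) * (n + 2))) ^ 2 := by
    have h6 : ((n : ℝ) + 3) * (n + 4) ≤ 64 / 25 * ((n + 1) * (n + 2)) := by nlinarith
    calc ((n : ℝ) + 1) * (n + 2) * ((n + 3) * (n + 4))
        ≤ (n + 1) * (n + 2) * (64 / 25 * ((n + 1) * (n + 2))) := by gcongr
      _ = _ := by ring
  calc ((n : ℝ) + 1) * (n + 2) * ((n + 3) * (n + 4)) * (‖R⁻¹ • v‖ ^ 2) ^ 2 *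
        (ballDefect ω R (x + t • v))⁻¹ ^ (n + 5) * ‖f‖ ^ 2
      ≤ (8 / 5 * ((n + 1) * (n + 2))) ^ 2 * (‖R⁻¹ • v‖ ^ 2) ^ 2 * (e⁻¹ ^ 2) ^ (n + 5) *
          ‖f‖ ^ 2 := by
        gcongr
    _ = _ := by ring

end BergmanSpace

/-! ### Completeness of the Bergman space -/

/-- An integral against a power of the kernel is analytic in the parameter of the kernel: the
inverse is taken in the Banach algebra of bounded continuous functions on the ball. -/
theorem analyticAt_setIntegral_ballKernel {n : ℕ} {ω : Cn n} {R : ℝ} (hR : 0 < R) {G : Cn n → ℂ}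
    (hG : IntegrableOn G (ball ω R)) (m : ℕ) {x : Cn n} (hx : x ∈ ball ω R) :
    AnalyticAt ℂ (fun x => ∫ z in ball ω R, ballKernel ω R z x ^ m * G z) x := by
  have hint : Integrable (fun z : ball ω R => G z) (volume.comap Subtype.val) :=
    (integrableOn_iff_comap_subtypeVal measurableSet_ball).1 hG
  have hmul : ∀ a : BoundedContinuousFunction (ball ω R) ℂ, Integrable (fun z : ball ω R => a z * G z) (volume.comap Subtype.val) :=
    fun a => hint.bdd_mul a.continuous.aestronglyMeasurable
      (Eventually.of_forall fun z => a.norm_coe_le_norm z)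
  let Λ : BoundedContinuousFunction (ball ω R) ℂ →L[ℂ] ℂ := LinearMap.mkContinuous
    { toFun := fun a => ∫ z : ball ω R, a z * G z ∂(volume.comap Subtype.val)
      map_add' := fun a b => by
        rw [← integral_add (hmul a) (hmul b)]
        exact integral_congr_ae (Eventually.of_forall fun z => add_mul (a z) (b z) (G z))
      map_smul' := fun c a => by
        rw [RingHom.id_apply, smul_eq_mul, ← integral_const_mul]
        exact integral_congr_ae (Eventually.of_forall fun z => mul_assoc c (a z) (G z)) }
    (∫ z : ball ω R, ‖G z‖ ∂(volume.comap Subtype.val)) fun a => by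
      refine (norm_integral_le_integral_norm _).trans ?_
      rw [mul_comm, ← integral_const_mul]
      refine integral_mono (hmul a).norm (hint.norm.const_mul _) fun z => ?_
      change ‖a z * G z‖ ≤ _
      rw [norm_mul]
      gcongr
      exact a.norm_coe_le_norm z
  have hzn : ∀ z : ball ω R, ‖ballCoord ω R z‖ ≤ 1 := fun z =>
    ((norm_ballCoord_lt_one hR).2 z.2).le
  have hcoord := continuous_ballCoord ω R
  let ℓ : Cn n →L[ℂ] BoundedContinuousFunction (ball ω R) ℂ := LinearMap.mkContinuous
    { toFun := fun v => BoundedContinuousFunction.ofNormedAddCommGroup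
        (fun z : ball ω R => inner ℂ (ballCoord ω R z) v) (by fun_prop) ‖v‖ fun z =>
          (norm_inner_le_norm _ _).trans (mul_le_of_le_one_left (norm_nonneg v) (hzn z))
      map_add' := fun v w => by
        ext z
        exact inner_add_right (𝕜 := ℂ) (ballCoord ω R z) v w
      map_smul' := fun c v => by
        ext z
        exact inner_smul_right (𝕜 := ℂ) (ballCoord ω R z) v c }
    1 fun v => by
      rw [one_mul]
      exact (BoundedContinuousFunction.norm_le (norm_nonneg v)).2 fun z =>
        (norm_inner_le_norm _ _).trans (mul_le_of_le_one_left (norm_nonneg v) (hzn z))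
  have hunit : ∀ y ∈ ball ω R, IsUnit (1 - ℓ (ballCoord ω R y)) := fun y hy => by
    refine (Units.oneSub (ℓ (ballCoord ω R y)) ?_).isUnit
    refine lt_of_le_of_lt ?_ ((norm_ballCoord_lt_one hR).2 hy)
    exact (BoundedContinuousFunction.norm_le (norm_nonneg _)).2 fun z =>
      (norm_inner_le_norm _ _).trans (mul_le_of_le_one_left (norm_nonneg _) (hzn z))
  have hinv : ∀ y ∈ ball ω R, ∀ z : ball ω R,
      (Ring.inverse (1 - ℓ (ballCoord ω R y)) :
        BoundedContinuousFunction (ball ω R) ℂ) z = ballKernel ω R z y := fun y hy z => by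
    have h := congrArg (fun a : BoundedContinuousFunction (ball ω R) ℂ => a z) (Ring.inverse_mul_cancel _ (hunit y hy))
    exact eq_inv_of_mul_eq_one_left h
  have hcoordA : AnalyticAt ℂ (ballCoord ω R) x := by
    have : ballCoord ω R = fun z => (R⁻¹ : ℂ) • (z - ω) := by
      funext z
      rw [ballCoord, ← Complex.coe_smul, Complex.ofReal_inv]
    rw [this]
    fun_prop
  have hana : AnalyticAt ℂ (fun y => Λ (Ring.inverse (1 - ℓ (ballCoord ω R y)) ^ m)) x := by
    obtain ⟨u, hu⟩ := hunit x hx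
    have h1 : AnalyticAt ℂ (fun y => 1 - ℓ (ballCoord ω R y)) x :=
      analyticAt_const.sub ((ℓ.analyticAt _).comp hcoordA)
    have h2 : AnalyticAt ℂ (Ring.inverse : BoundedContinuousFunction (ball ω R) ℂ → _) (1 - ℓ (ballCoord ω R x)) := by
      rw [← hu]
      exact analyticAt_inverse u
    exact (Λ.analyticAt _).comp ((AnalyticAt.comp (f := fun y => 1 - ℓ (ballCoord ω R y)) h2 h1).pow m)
  refine hana.congr ?_
  filter_upwards [isOpen_ball.mem_nhds hx] with y hy
  rw [← integral_subtype_comap measurableSet_ball]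
  refine integral_congr_ae (Eventually.of_forall fun z => ?_)
  change (Ring.inverse (1 - ℓ (ballCoord ω R y)) ^ m :
        BoundedContinuousFunction (ball ω R) ℂ) z * G z = _
  rw [BoundedContinuousFunction.pow_apply, hinv y hy z]

namespace BergmanSpace

variable {n : ℕ} {ω : Cn n} {R : ℝ}

theorem normConst_pos (n : ℕ) (hR : 0 < R) : 0 < normConst n R := by
  unfold normConst
  positivity

/-- The isometric embedding of the Bergman space into `L²` of the ball. -/
def toL2 (ω : Cn n) (R : ℝ) :
    BergmanSpace ω R →ₗᵢ[ℂ] Lp ℂ 2 (volume.restrict (ball ω R)) where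
  toFun f := ((√(normConst n R) : ℝ) : ℂ) • f.2.2.1.toLp f
  map_add' f g := by
    rw [← smul_add]
    rfl
  map_smul' c f := by
    rw [RingHom.id_apply, smul_comm]
    rfl
  norm_map' f := by
    have h1 : ‖f‖ ^ 2 = normConst n R * ∫ z in ball ω R, ‖f z‖ ^ 2 := by
      have h : ((‖f‖ ^ 2 : ℝ) : ℂ) = inner ℂ f f := by
        rw [inner_self_eq_norm_sq_to_K]
        push_cast
        rfl
      rw [inner_self_eq] at h
      exact_mod_cast h
    have h2 : ‖f.2.2.1.toLp f‖ ^ 2 = ∫ z in ball ω R, ‖f z‖ ^ 2 := by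
      have h : ((‖f.2.2.1.toLp f‖ ^ 2 : ℝ) : ℂ) = inner ℂ (f.2.2.1.toLp f) (f.2.2.1.toLp f) := by
        rw [inner_self_eq_norm_sq_to_K]
        push_cast
        rfl
      have h3 : (inner ℂ (f.2.2.1.toLp f) (f.2.2.1.toLp f) : ℂ) =
          ((∫ z in ball ω R, ‖f z‖ ^ 2 : ℝ) : ℂ) := by
        rw [L2.inner_def, ← integral_complex_ofReal]
        refine integral_congr_ae ?_
        filter_upwards [f.2.2.1.coeFn_toLp] with z hz
        rw [hz, inner_self_eq_norm_sq_to_K]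
        push_cast
        rfl
      rw [h3] at h
      exact_mod_cast h
    rw [← sq_eq_sq₀ (norm_nonneg _) (norm_nonneg _)]
    change ‖((√(normConst n R) : ℝ) : ℂ) • f.2.2.1.toLp f‖ ^ 2 = ‖f‖ ^ 2
    rw [norm_smul, mul_pow, h2, h1, Complex.norm_real, Real.norm_of_nonneg (Real.sqrt_nonneg _),
      Real.sq_sqrt (normConst_nonneg n R)]

theorem coeFn_toL2 (f : BergmanSpace ω R) :
    toL2 ω R f =ᵐ[volume.restrict (ball ω R)] fun z => ((√(normConst n R) : ℝ) : ℂ) * f z := by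
  filter_upwards [Lp.coeFn_smul ((√(normConst n R) : ℝ) : ℂ) (f.2.2.1.toLp f),
    f.2.2.1.coeFn_toLp] with z h1 h2
  change (((√(normConst n R) : ℝ) : ℂ) • f.2.2.1.toLp f) z = _
  rw [h1, Pi.smul_apply, h2, smul_eq_mul]

/-- The Bergman space is complete. A limit in `L²` of elements of the space is represented by its
integral against the Bergman kernel, which is analytic. -/
theorem completeSpace (hn : 1 ≤ n) (hR : 0 < R) : CompleteSpace (BergmanSpace ω R) := by
  rw [completeSpace_iff_isComplete_range (toL2 ω R).isometry.isUniformInducing]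
  refine IsClosed.isComplete (IsSeqClosed.isClosed fun U F hU hF => ?_)
  choose u hu using hU
  set s : ℂ := ((√(normConst n R) : ℝ) : ℂ) with hs
  have hspos := Real.sqrt_pos.2 (normConst_pos n hR)
  have hs0 : s ≠ 0 := Complex.ofReal_ne_zero.2 hspos.ne'
  have hFL2 : MemLp F 2 (volume.restrict (ball ω R)) := Lp.memLp F
  have hFint : IntegrableOn F (ball ω R) := hFL2.integrable one_le_two
  set G : Cn n → ℂ := fun x => s * ∫ z in ball ω R, ballKernel ω R z x ^ (n + 1) * F z with hG
  have hlim : ∀ x ∈ ball ω R, Tendsto (fun m => u m x) atTop (𝓝 (G x)) := fun x hx => by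
    have h1 : Tendsto (fun m => inner ℂ (toL2 ω R (kernel hR hx 0 0 (n + 1))) (U m)) atTop
        (𝓝 (inner ℂ (toL2 ω R (kernel hR hx 0 0 (n + 1))) F)) :=
      tendsto_const_nhds.inner hF
    have h2 : ∀ m, inner ℂ (toL2 ω R (kernel hR hx 0 0 (n + 1))) (U m) = u m x := fun m => by
      rw [← hu m, LinearIsometry.inner_map_map, inner_kernel, kernelPairing_eq_apply hn hR _ _ hx]
    have h3 : inner ℂ (toL2 ω R (kernel hR hx 0 0 (n + 1))) F = G x := by
      simp only [L2.inner_def, hG]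
      rw [← integral_const_mul]
      refine integral_congr_ae ?_
      filter_upwards [coeFn_toL2 (kernel hR hx 0 0 (n + 1)),
        ae_restrict_mem measurableSet_ball] with z h4 hz
      rw [h4, RCLike.inner_apply, map_mul, conj_kernel_apply hR hx 0 0 (n + 1) hz, kernelMonomial,
        pow_zero, one_mul, Complex.conj_ofReal]
      ring
    simp only [h2, h3] at h1
    exact h1
  have hae : ∀ᵐ z ∂volume.restrict (ball ω R), F z = s * G z := by
    obtain ⟨φ, hmono, hφ⟩ := (tendstoInMeasure_of_tendsto_Lp hF).exists_seq_tendsto_ae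
    have h1 : ∀ᵐ z ∂volume.restrict (ball ω R), ∀ m, U m z = s * u m z := by
      rw [ae_all_iff]
      intro m
      rw [← hu m]
      exact coeFn_toL2 (u m)
    filter_upwards [hφ, h1, ae_restrict_mem measurableSet_ball] with z h2 h3 hz
    refine tendsto_nhds_unique h2 ?_
    simp only [h3]
    exact ((hlim z hz).comp hmono.tendsto_atTop).const_mul s
  have hGana : AnalyticOnNhd ℂ G (ball ω R) := fun x hx =>
    analyticAt_const.mul (analyticAt_setIntegral_ballKernel hR hFint (n + 1) hx)
  have hind : ∀ z ∈ ball ω R, (ball ω R).indicator G z = G z := fun z hz =>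
    Set.indicator_of_mem hz G
  have hGL2 : MemLp ((ball ω R).indicator G) 2 (volume.restrict (ball ω R)) := by
    refine (hFL2.const_mul s⁻¹).ae_eq ?_
    filter_upwards [hae, ae_restrict_mem measurableSet_ball] with z h1 hz
    rw [h1, hind z hz, ← mul_assoc, inv_mul_cancel₀ hs0, one_mul]
  let g : BergmanSpace ω R := ⟨(ball ω R).indicator G, fun z hz => (hGana z hz).congr (by
    filter_upwards [isOpen_ball.mem_nhds hz] with w hw using (hind w hw).symm), hGL2,
    fun z hz => Set.indicator_of_notMem hz G⟩
  refine ⟨g, Lp.ext ?_⟩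
  filter_upwards [hae, coeFn_toL2 g, ae_restrict_mem measurableSet_ball] with z h1 h2 hz
  rw [h1, h2, ← hs]
  exact congrArg (s * ·) (hind z hz)

end BergmanSpace

/-! ### Moore–Penrose inverses of surjective operators -/

/-- A surjective operator from a Hilbert space to a finite-dimensional space has a Moore–Penrose
inverse: follow any right inverse by the orthogonal projection onto the complement of the kernel.
It picks the solution of least norm. -/
theorem exists_isMoorePenroseInverse {E F : Type*} [NormedAddCommGroup E] [InnerProductSpace ℂ E]
    [CompleteSpace E] [NormedAddCommGroup F] [InnerProductSpace ℂ F] [FiniteDimensional ℂ F]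
    (T : E →L[ℂ] F) (hT : Function.Surjective T) :
    ∃ X, IsMoorePenroseInverse T X ∧ (∀ v, T (X v) = v) ∧ ∀ u, ‖X (T u)‖ ≤ ‖u‖ := by
  have hclosed : IsClosed (T.ker : Set E) := T.isClosed_ker
  have : CompleteSpace T.ker := hclosed.completeSpace_coe
  obtain ⟨S, hS⟩ := (T : E →ₗ[ℂ] F).exists_rightInverse_of_surjective
    (LinearMap.range_eq_top.2 hT)
  have hTS : ∀ v, T (S v) = v := fun v => LinearMap.congr_fun hS v
  set P : E →L[ℂ] E := T.kerᗮ.starProjection with hP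
  have hTP : ∀ u, T (P u) = T u := fun u => by
    have h1 : u - P u ∈ T.ker := by
      have h2 := Submodule.sub_starProjection_mem_orthogonal (K := T.kerᗮ) u
      rwa [Submodule.orthogonal_orthogonal] at h2
    have h3 : T (u - P u) = 0 := h1
    rw [map_sub, sub_eq_zero] at h3
    exact h3.symm
  have hPker : ∀ u, T u = 0 → P u = 0 := fun u hu => by
    rw [hP, Submodule.starProjection_apply_eq_zero_iff, Submodule.orthogonal_orthogonal]
    exact hu
  have hXT : ∀ u, P (S (T u)) = P u := fun u => by
    rw [← sub_eq_zero, ← map_sub]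
    exact hPker _ (by rw [map_sub, hTS, sub_self])
  refine ⟨P.comp S.toContinuousLinearMap, ⟨fun u => ?_, fun v => ?_, fun v w => ?_, fun u w => ?_⟩,
    fun v => ?_, fun u => ?_⟩
  · exact (hTP _).trans (hTS _)
  · change P (S (T (P (S v)))) = P (S v)
    rw [hTP, hTS]
  · change inner ℂ (T (P (S v))) w = inner ℂ v (T (P (S w)))
    rw [hTP, hTP, hTS, hTS]
  · change inner ℂ (P (S (T u))) w = inner ℂ u (P (S (T w)))
    rw [hXT, hXT]
    exact Submodule.inner_starProjection_left_eq_right _ u w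
  · exact (hTP _).trans (hTS _)
  · change ‖P (S (T u))‖ ≤ ‖u‖
    rw [hXT]
    exact Submodule.norm_starProjection_apply_le _ u

theorem isMoorePenroseInverse_moorePenrose {E F : Type*} [NormedAddCommGroup E]
    [InnerProductSpace ℂ E] [CompleteSpace E] [NormedAddCommGroup F] [InnerProductSpace ℂ F]
    [FiniteDimensional ℂ F] {T : E →L[ℂ] F} (hT : Function.Surjective T) :
    IsMoorePenroseInverse T (moorePenrose T) ∧ (∀ v, T (moorePenrose T v) = v) ∧
      ∀ u, ‖moorePenrose T (T u)‖ ≤ ‖u‖ := by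
  obtain ⟨X, hX, h⟩ := exists_isMoorePenroseInverse T hT
  rw [hX.moorePenrose_eq]
  exact ⟨hX, h⟩

/-! ### The derivative of the evaluation map -/

section Evaluation

variable {n s : ℕ} {ω : Cn n} {R : ℝ}

/-- Coordinatewise bounds `|rᵢ| ≤ c ‖fᵢ‖` add up in the `ℓ²` norms. -/
theorem norm_toLp_le_mul {ι : Type*} [Fintype ι] {E : ι → Type*} [∀ i, SeminormedAddCommGroup (E i)]
    {r : ι → ℂ} {f : PiLp 2 E} {c : ℝ} (hc : 0 ≤ c) (h : ∀ i, ‖r i‖ ≤ c * ‖f i‖) :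
    ‖(WithLp.toLp 2 r : EuclideanSpace ℂ ι)‖ ≤ c * ‖f‖ := by
  refine le_of_sq_le_sq ?_ (by positivity)
  rw [EuclideanSpace.norm_sq_eq, mul_pow, PiLp.norm_sq_eq_of_L2, Finset.mul_sum]
  refine Finset.sum_le_sum fun i _ => ?_
  rw [← mul_pow]
  gcongr
  exact h i

/-- Evaluation at a point of the ball, as a continuous linear functional. -/
def BergmanSpace.evalCLM (hR : 0 < R) {x : Cn n} (hx : x ∈ ball ω R) : BergmanSpace ω R →L[ℂ] ℂ :=
  innerSL ℂ (BergmanSpace.kernel hR hx 0 0 (n + 1))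

theorem BergmanSpace.evalCLM_apply (hn : 1 ≤ n) (hR : 0 < R) {x : Cn n} (hx : x ∈ ball ω R)
    (f : BergmanSpace ω R) : BergmanSpace.evalCLM hR hx f = f x := by
  rw [BergmanSpace.evalCLM, innerSL_apply_apply, BergmanSpace.inner_kernel,
    BergmanSpace.kernelPairing_eq_apply hn hR f 0 hx]

/-- The derivative `(g, v) ↦ g(x) + Df(x) v` of the evaluation map at `(f, x)`. -/
def evalDeriv (hR : 0 < R) (p : SystemPoint s ω R) (hp : p.snd ∈ ball ω R) :
    SystemPoint s ω R →L[ℂ] Cn s :=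
  ((EuclideanSpace.equiv (Fin s) ℂ).symm : (Fin s → ℂ) →L[ℂ] Cn s).comp
    (ContinuousLinearMap.pi fun i =>
      (BergmanSpace.evalCLM hR hp).comp ((PiLp.proj 2 (fun _ : Fin s => BergmanSpace ω R) i :
        BergmanSystem s ω R →L[ℂ] BergmanSpace ω R).comp
          (WithLp.fstL 2 ℂ (BergmanSystem s ω R) (Cn n))) +
        (fderiv ℂ (p.fst i) p.snd).comp (WithLp.sndL 2 ℂ (BergmanSystem s ω R) (Cn n)))

theorem evalDeriv_apply (hn : 1 ≤ n) (hR : 0 < R) (p : SystemPoint s ω R) (hp : p.snd ∈ ball ω R)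
    (q : SystemPoint s ω R) :
    evalDeriv hR p hp q = WithLp.toLp 2 fun i => q.fst i p.snd + fderiv ℂ (p.fst i) p.snd q.snd := by
  ext i
  change BergmanSpace.evalCLM hR hp (q.fst i) + fderiv ℂ (p.fst i) p.snd q.snd = _
  rw [BergmanSpace.evalCLM_apply hn hR hp]

/-- `ballDefect` is at least `e²` on a segment if it is so at the ends. -/
theorem le_ballDefect_segment {x v : Cn n} {e : ℝ} (h0 : e ^ 2 ≤ ballDefect ω R x)
    (h1 : e ^ 2 ≤ ballDefect ω R (x + v)) {t : ℝ} (ht : t ∈ Set.Icc (0 : ℝ) 1) :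
    e ^ 2 ≤ ballDefect ω R (x + t • v) := by
  have h2 : ballCoord ω R (x + t • v) =
      (1 - t) • ballCoord ω R x + t • ballCoord ω R (x + v) := by
    simp only [ballCoord_add]
    module
  simp only [ballDefect] at h0 h1 ⊢
  set a := ‖ballCoord ω R x‖
  set b := ‖ballCoord ω R (x + v)‖
  have h3 : ‖ballCoord ω R (x + t • v)‖ ≤ (1 - t) * a + t * b := by
    rw [h2]
    refine (norm_add_le _ _).trans_eq ?_
    rw [norm_smul, norm_smul, Real.norm_of_nonneg ht.1, Real.norm_of_nonneg (sub_nonneg.2 ht.2)]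
  have h4 : ‖ballCoord ω R (x + t • v)‖ ^ 2 ≤ ((1 - t) * a + t * b) ^ 2 := by gcongr
  have h5 := mul_nonneg (mul_nonneg ht.1 (sub_nonneg.2 ht.2)) (sq_nonneg (a - b))
  nlinarith [mul_le_mul_of_nonneg_left h0 (sub_nonneg.2 ht.2), mul_le_mul_of_nonneg_left h1 ht.1]

theorem ballDefect_pos_iff (hR : 0 < R) {x : Cn n} : 0 < ballDefect ω R x ↔ x ∈ ball ω R := by
  rw [← norm_ballCoord_lt_one hR, ballDefect, sub_pos, sq_lt_one_iff₀ (norm_nonneg _)]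

/-- The quadratic Taylor remainder of the evaluation map, where `e²` is a lower bound for
`ballDefect` at both ends. -/
theorem norm_evalMap_taylor_le (hn : 2 ≤ n) (hR : 0 < R) (p q : SystemPoint s ω R)
    (hp : p.snd ∈ ball ω R) {e : ℝ} (he : 0 < e) (h0 : e ^ 2 ≤ ballDefect ω R p.snd)
    (h1 : e ^ 2 ≤ ballDefect ω R (p.snd + q.snd)) :
    ‖evalMap (p + q) - evalMap p - evalDeriv hR p hp q‖ ≤
      4 / 5 * ((n + 1) * (n + 2)) * ‖R⁻¹ • q.snd‖ ^ 2 * e⁻¹ ^ (n + 5) * ‖p.fst‖ +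
      3 / 10 * ((n + 1) * (n + 2)) * ‖R⁻¹ • q.snd‖ * e⁻¹ ^ (n + 3) * ‖q.fst‖ := by
  have hpq : p.snd + q.snd ∈ ball ω R :=
    (ballDefect_pos_iff hR).1 ((by positivity : 0 < e ^ 2).trans_le h1)
  have hd := fun t ht => le_ballDefect_segment (t := t) h0 h1 ht
  have hsplit : evalMap (p + q) - evalMap p - evalDeriv hR p hp q =
      WithLp.toLp 2 (fun i => p.fst i (p.snd + q.snd) - p.fst i p.snd -
        fderiv ℂ (p.fst i) p.snd q.snd) +
      WithLp.toLp 2 (fun i => q.fst i (p.snd + q.snd) - q.fst i p.snd) := by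
    rw [evalDeriv_apply (by omega) hR]
    ext i
    change (p.fst i (p.snd + q.snd) + q.fst i (p.snd + q.snd)) - p.fst i p.snd -
      (q.fst i p.snd + fderiv ℂ (p.fst i) p.snd q.snd) =
      (p.fst i (p.snd + q.snd) - p.fst i p.snd - fderiv ℂ (p.fst i) p.snd q.snd) +
      (q.fst i (p.snd + q.snd) - q.fst i p.snd)
    ring
  rw [hsplit]
  refine (norm_add_le _ _).trans (add_le_add ?_ ?_)
  · exact norm_toLp_le_mul (by positivity) fun i =>
      BergmanSpace.norm_taylor_le hn hR (p.fst i) hp hpq he hd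
  · exact norm_toLp_le_mul (by positivity) fun i =>
      BergmanSpace.norm_add_sub_le hn hR (q.fst i) hp hpq he hd

theorem SystemPoint.norm_fst_le (q : SystemPoint s ω R) : ‖q.fst‖ ≤ ‖q‖ := by
  refine le_of_sq_le_sq ?_ (norm_nonneg q)
  rw [WithLp.prod_norm_sq_eq_of_L2]
  exact le_add_of_nonneg_right (by positivity)

theorem SystemPoint.norm_snd_le (q : SystemPoint s ω R) : ‖q.snd‖ ≤ ‖q‖ := by
  refine le_of_sq_le_sq ?_ (norm_nonneg q)
  rw [WithLp.prod_norm_sq_eq_of_L2]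
  exact le_add_of_nonneg_left (by positivity)

theorem norm_inv_smul (hR : 0 < R) (v : Cn n) : ‖R⁻¹ • v‖ = ‖v‖ / R := by
  rw [norm_smul, Real.norm_of_nonneg (inv_nonneg.2 hR.le), inv_mul_eq_div]

theorem continuous_ballDefect (ω : Cn n) (R : ℝ) : Continuous (ballDefect ω R) := by
  have := continuous_ballCoord ω R
  unfold ballDefect
  fun_prop

theorem hasFDerivAt_evalMap (hn : 2 ≤ n) (hR : 0 < R) (p : SystemPoint s ω R)
    (hp : p.snd ∈ ball ω R) : HasFDerivAt evalMap (evalDeriv hR p hp) p := by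
  have hd := ballDefect_pos hR hp
  set e := √(ballDefect ω R p.snd / 2) with he
  have he0 : 0 < e := Real.sqrt_pos.2 (by positivity)
  have he2 : e ^ 2 = ballDefect ω R p.snd / 2 := Real.sq_sqrt (by positivity)
  rw [hasFDerivAt_iff_isLittleO_nhds_zero]
  refine Asymptotics.IsBigO.trans_isLittleO (g := fun q : SystemPoint s ω R => ‖q‖ ^ 2) ?_
    (Asymptotics.isLittleO_norm_pow_id one_lt_two)
  refine Asymptotics.IsBigO.of_bound
    (4 / 5 * ((n + 1) * (n + 2)) * R⁻¹ ^ 2 * e⁻¹ ^ (n + 5) * ‖p.fst‖ +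
      3 / 10 * ((n + 1) * (n + 2)) * R⁻¹ * e⁻¹ ^ (n + 3)) ?_
  have hcont : Continuous fun q : SystemPoint s ω R => ballDefect ω R (p.snd + q.snd) :=
    (continuous_ballDefect ω R).comp
      (continuous_const.add (WithLp.sndL 2 ℂ (BergmanSystem s ω R) (Cn n)).continuous)
  have h1 : ∀ᶠ q : SystemPoint s ω R in 𝓝 0,
      ballDefect ω R p.snd / 2 < ballDefect ω R (p.snd + q.snd) := by
    refine hcont.continuousAt.eventually (lt_mem_nhds ?_)
    change _ < ballDefect ω R (p.snd + 0)
    rw [add_zero]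
    linarith
  filter_upwards [h1] with q hq
  refine (norm_evalMap_taylor_le hn hR p q hp he0 (by linarith) (by linarith)).trans ?_
  rw [Real.norm_of_nonneg (by positivity), norm_inv_smul hR, div_eq_inv_mul ‖q.snd‖]
  have h2 := SystemPoint.norm_fst_le q
  have h3 := SystemPoint.norm_snd_le q
  calc _ ≤ 4 / 5 * ((n + 1) * (n + 2)) * (R⁻¹ * ‖q‖) ^ 2 * e⁻¹ ^ (n + 5) * ‖p.fst‖ +
      3 / 10 * ((n + 1) * (n + 2)) * (R⁻¹ * ‖q‖) * e⁻¹ ^ (n + 3) * ‖q‖ := by gcongr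
    _ = _ := by ring

/-- Multiples of the Bergman kernel show that the derivative of the evaluation map is onto, with a
right inverse of norm at most `(1 - ν_x²)^((n + 1) / 2)`. -/
theorem exists_evalDeriv_eq (hn : 1 ≤ n) (hR : 0 < R) (p : SystemPoint s ω R)
    (hp : p.snd ∈ ball ω R) (c : Cn s) :
    ∃ u, evalDeriv hR p hp u = c ∧ ‖u‖ ≤ √(ballDefect ω R p.snd) ^ (n + 1) * ‖c‖ := by
  have hd := ballDefect_pos hR hp
  set d := ballDefect ω R p.snd with hdd
  set k := BergmanSpace.kernel hR hp 0 0 (n + 1) with hk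
  have hkn : ‖k‖ ^ 2 = d⁻¹ ^ (n + 1) := BergmanSpace.norm_sq_kernel_zero hn hR hp 0
  have hkp : k p.snd = ((d⁻¹ ^ (n + 1) : ℝ) : ℂ) := by
    rw [← hkn, BergmanSpace.norm_sq_kernel hR hp 0 0 (n + 1),
      BergmanSpace.kernelPairing_eq_apply hn hR _ 0 hp]
  have hdC : (d : ℂ) ≠ 0 := Complex.ofReal_ne_zero.2 hd.ne'
  refine ⟨WithLp.toLp 2 (WithLp.toLp 2 fun i => (c i * (d : ℂ) ^ (n + 1)) • k, 0), ?_, ?_⟩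
  · rw [evalDeriv_apply hn hR]
    ext i
    change (c i * (d : ℂ) ^ (n + 1)) * k p.snd + fderiv ℂ (p.fst i) p.snd 0 = c i
    rw [map_zero, add_zero, hkp]
    push_cast
    rw [mul_assoc, ← mul_pow, mul_inv_cancel₀ hdC, one_pow, mul_one]
  · refine le_of_sq_le_sq ?_ (by positivity)
    rw [WithLp.prod_norm_sq_eq_of_L2, PiLp.norm_sq_eq_of_L2, mul_pow, EuclideanSpace.norm_sq_eq c,
      Finset.mul_sum]
    change ∑ i, ‖(c i * (d : ℂ) ^ (n + 1)) • k‖ ^ 2 + ‖(0 : Cn n)‖ ^ 2 ≤ _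
    rw [norm_zero, zero_pow two_ne_zero, add_zero]
    refine Finset.sum_le_sum fun i _ => ?_
    rw [norm_smul, mul_pow, hkn, norm_mul, norm_pow, Complex.norm_real,
      Real.norm_of_nonneg hd.le, ← pow_mul, mul_comm (n + 1) 2, pow_mul, Real.sq_sqrt hd.le, inv_pow]
    refine le_of_eq ?_
    field_simp

theorem surjective_fderiv_evalMap (hn : 2 ≤ n) (hR : 0 < R) (p : SystemPoint s ω R)
    (hp : p.snd ∈ ball ω R) :
    Function.Surjective (fderiv ℂ (evalMap (s := s) (ω := ω) (R := R)) p) := by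
  rw [(hasFDerivAt_evalMap hn hR p hp).fderiv]
  intro c
  obtain ⟨u, hu, -⟩ := exists_evalDeriv_eq (by omega) hR p hp c
  exact ⟨u, hu⟩

variable [CompleteSpace (BergmanSpace ω R)]

theorem evalDeriv_newtonStep_sub (hn : 2 ≤ n) (hR : 0 < R) (p : SystemPoint s ω R)
    (hp : p.snd ∈ ball ω R) : evalDeriv hR p hp (newtonStep p - p) = -evalMap p := by
  have h := (isMoorePenroseInverse_moorePenrose (surjective_fderiv_evalMap hn hR p hp)).2.1
    (evalMap p)
  rw [(hasFDerivAt_evalMap hn hR p hp).fderiv] at h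
  rw [newtonStep, (hasFDerivAt_evalMap hn hR p hp).fderiv, sub_sub_cancel_left, map_neg, h]

theorem norm_newtonStep_sub_le (hn : 2 ≤ n) (hR : 0 < R) (p : SystemPoint s ω R)
    (hp : p.snd ∈ ball ω R) :
    ‖newtonStep p - p‖ ≤ √(ballDefect ω R p.snd) ^ (n + 1) * ‖evalMap p‖ := by
  obtain ⟨u, hu, hu2⟩ := exists_evalDeriv_eq (by omega) hR p hp (evalMap p)
  have h := (isMoorePenroseInverse_moorePenrose (surjective_fderiv_evalMap hn hR p hp)).2.2 u
  rw [(hasFDerivAt_evalMap hn hR p hp).fderiv, hu] at h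
  rw [newtonStep, (hasFDerivAt_evalMap hn hR p hp).fderiv, sub_sub_cancel_left, norm_neg]
  exact h.trans hu2

end Evaluation

/-! ### Quadratic convergence of an iteration -/

theorem c₀_le_two : c₀ ≤ 2 := by
  rw [← tsum_geometric_two]
  refine summable_c₀.tsum_le_tsum (fun k => ?_) summable_geometric_two
  exact pow_le_pow_of_le_one (by norm_num) (by norm_num) (Nat.le_sub_one_of_lt k.lt_two_pow_self)

theorem α₀_le : α₀ ≤ 3 / 20 := by
  have hcont : Continuous fun u : ℝ => (1 - 4 * u + 2 * u ^ 2) ^ 2 - 2 * u := by fun_prop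
  obtain ⟨u, hu, h0⟩ := intermediate_value_Icc' (by norm_num : (0 : ℝ) ≤ 3 / 20)
    hcont.continuousOn (show (0 : ℝ) ∈ Set.Icc _ _ by constructor <;> norm_num)
  refine (isLeast_α₀.2 ⟨lt_of_le_of_ne hu.1 ?_, h0⟩).trans hu.2
  rintro rfl
  norm_num at h0

/-- A fixed point iteration whose steps satisfy `βₖ₊₁ ≤ a βₖ²` with `a β₀ ≤ 1 / 2` stays within
`c₀ β₀` of its starting point and converges quadratically. -/
theorem convergesQuadratically_iterate {E : Type*} [NormedAddCommGroup E] [CompleteSpace E]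
    {N : E → E} {p : E} {a b : ℝ} (ha : 0 ≤ a) (hb : 0 ≤ b) (hab : a * b ≤ 1 / 2)
    (h0 : ‖N p - p‖ ≤ b)
    (hstep : ∀ q, ‖q - p‖ ≤ c₀ * b → ‖N q - p‖ ≤ c₀ * b →
      ‖N (N q) - N q‖ ≤ a * ‖N q - q‖ ^ 2) :
    (∀ k, ‖N^[k] p - p‖ ≤ c₀ * b) ∧
      ∃ l, ConvergesQuadratically (fun k => N^[k] p) l ∧ ‖p - l‖ ≤ c₀ * b := by
  set u : ℕ → E := fun k => N^[k] p with hu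
  have husucc : ∀ k, u (k + 1) = N (u k) := fun k => Function.iterate_succ_apply' N k p
  set w : ℕ → ℝ := fun k => (1 / 2 : ℝ) ^ (2 ^ k - 1) with hw
  have hpart : ∀ k, (∑ j ∈ Finset.range k, w j) * b ≤ c₀ * b := fun k =>
    mul_le_mul_of_nonneg_right (summable_c₀.sum_le_tsum _ fun j _ => by positivity) hb
  have hwsucc : ∀ k, w (k + 1) = 1 / 2 * (w k) ^ 2 := fun k => by
    have h1 : 1 ≤ 2 ^ k := Nat.one_le_two_pow
    simp only [hw]
    rw [← pow_mul, ← pow_succ']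
    congr 1
    rw [pow_succ 2 k]
    omega
  have key : ∀ k, ‖u k - p‖ ≤ (∑ j ∈ Finset.range k, w j) * b ∧ ‖u (k + 1) - u k‖ ≤ w k * b := by
    intro k
    induction k with
    | zero =>
      refine ⟨by simp [hu], ?_⟩
      simpa [hu, hw] using h0
    | succ k ih =>
      have h1 : ‖u (k + 1) - p‖ ≤ (∑ j ∈ Finset.range (k + 1), w j) * b := by
        rw [Finset.sum_range_succ, add_mul]
        have := norm_add_le (u k - p) (u (k + 1) - u k)
        rw [add_comm, sub_add_sub_cancel] at this
        linarith [ih.1, ih.2]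
      refine ⟨h1, ?_⟩
      have h2 := hstep (u k) (ih.1.trans (hpart k))
        (by rw [← husucc]; exact h1.trans (hpart (k + 1)))
      rw [← husucc, ← husucc] at h2
      have hwk : 0 ≤ w k := by positivity
      calc ‖u (k + 1 + 1) - u (k + 1)‖ ≤ a * ‖u (k + 1) - u k‖ ^ 2 := h2
        _ ≤ a * (w k * b) ^ 2 := by gcongr; exact ih.2
        _ = (a * b) * (w k ^ 2 * b) := by ring
        _ ≤ 1 / 2 * (w k ^ 2 * b) := by gcongr
        _ = w (k + 1) * b := by rw [hwsucc]; ring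
  have hdist : ∀ k, ‖u k - p‖ ≤ c₀ * b := fun k => (key k).1.trans (hpart k)
  have hquad : ∀ k, ‖u (k + 2) - u (k + 1)‖ ≤ a * ‖u (k + 1) - u k‖ ^ 2 := fun k => by
    have h2 := hstep (u k) (hdist k) (by rw [← husucc]; exact hdist (k + 1))
    rwa [← husucc, ← husucc] at h2
  have hw1 : ∀ k, w k ≤ 1 := fun k => pow_le_one₀ (by norm_num) (by norm_num)
  have haβ : ∀ k, a * ‖u (k + 1) - u k‖ ≤ 1 / 2 * w k := fun k => by
    have hwk : 0 ≤ w k := by positivity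
    calc a * ‖u (k + 1) - u k‖ ≤ a * (w k * b) := by gcongr; exact (key k).2
      _ = a * b * w k := by ring
      _ ≤ 1 / 2 * w k := by gcongr
  -- the steps decrease by a factor of at least `2`, and of at least `4` after the first one
  have hhalf : ∀ k, ‖u (k + 2) - u (k + 1)‖ ≤ 1 / 2 * ‖u (k + 1) - u k‖ := fun k => by
    refine (hquad k).trans ?_
    rw [sq, ← mul_assoc]
    gcongr
    linarith [haβ k, hw1 k]
  have hquarter : ∀ k, ‖u (k + 3) - u (k + 2)‖ ≤ 1 / 4 * ‖u (k + 2) - u (k + 1)‖ := fun k => by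
    refine (hquad (k + 1)).trans ?_
    rw [sq, ← mul_assoc]
    gcongr
    have h1 := haβ (k + 1)
    have h2 : w k ^ 2 ≤ 1 := pow_le_one₀ (by positivity) (hw1 k)
    rw [hwsucc] at h1
    linarith
  have hgeom : ∀ k i, dist (u (k + 1 + i)) (u (k + 1 + (i + 1))) ≤
      ‖u (k + 2) - u (k + 1)‖ * (1 / 4) ^ i := fun k i => by
    rw [dist_comm, dist_eq_norm]
    induction i with
    | zero => simp [add_assoc]
    | succ i ih =>
      have h1 := hquarter (k + i)
      have e1 : k + 1 + (i + 1 + 1) = k + i + 3 := by ring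
      have e2 : k + 1 + (i + 1) = k + i + 2 := by ring
      have e3 : k + 1 + i = k + i + 1 := by ring
      rw [e2, e3] at ih
      rw [e1, e2, pow_succ]
      linarith
  have hcauchy : CauchySeq u := by
    refine (cauchySeq_shift 1).1 ?_
    refine cauchySeq_of_le_geometric (1 / 4) ‖u 2 - u 1‖ (by norm_num) fun i => ?_
    have := hgeom 0 i
    rwa [zero_add, add_comm 1 i, add_comm 1 (i + 1)] at this
  obtain ⟨l, hl⟩ := cauchySeq_tendsto_of_complete hcauchy
  have htail : ∀ k, ‖u (k + 1) - l‖ ≤ 4 / 3 * ‖u (k + 2) - u (k + 1)‖ := fun k => by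
    have h1 : Tendsto (fun i => u (k + 1 + i)) atTop (𝓝 l) := by
      simp only [add_comm (k + 1)]
      exact (tendsto_add_atTop_iff_nat (k + 1)).2 hl
    have h2 := dist_le_of_le_geometric_of_tendsto₀ (1 / 4) _ (by norm_num) (hgeom k) h1
    rw [dist_eq_norm, add_zero] at h2
    refine h2.trans_eq ?_
    ring
  refine ⟨hdist, l, ⟨hl, 12 * a, fun k => ?_⟩, ?_⟩
  · have h1 := htail k
    have h2 := hhalf k
    have h3 : ‖u (k + 1) - u k‖ ≤ ‖u (k + 1) - l‖ + ‖u k - l‖ := by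
      rw [norm_sub_rev (u k) l]
      exact norm_sub_le_norm_sub_add_norm_sub _ _ _
    have h4 : ‖u (k + 1) - u k‖ ≤ 3 * ‖u k - l‖ := by linarith
    have h5 := hquad k
    calc ‖u (k + 1) - l‖ ≤ 4 / 3 * (a * ‖u (k + 1) - u k‖ ^ 2) := by linarith
      _ ≤ 4 / 3 * (a * (3 * ‖u k - l‖) ^ 2) := by gcongr
      _ = 12 * a * ‖u k - l‖ ^ 2 := by ring
  · rw [norm_sub_rev]
    exact le_of_tendsto (hl.sub_const p).norm (Eventually.of_forall hdist)

/-! ### Convergence of the Newton sequence -/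

/-- The relative variation of `ballDefect` over a distance `2 R ε (1 - ν²)` is at most `4 ε`. -/
theorem ballDefect_near {n : ℕ} {ω : Cn n} {R : ℝ} (hR : 0 < R) {x y : Cn n} {ε : ℝ}
    (hx : x ∈ ball ω R) (hε : ε ≤ 1 / 40)
    (hxy : ‖y - x‖ ≤ 2 * (ε * (R * ballDefect ω R x))) :
    ballDefect ω R x * (1 - 4 * ε) ≤ ballDefect ω R y ∧
      ballDefect ω R y ≤ ballDefect ω R x * (1 + 4 * ε) := by
  have hν1 : ‖ballCoord ω R x‖ < 1 := (norm_ballCoord_lt_one hR).2 hx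
  have hdpos := ballDefect_pos hR hx
  have hy : ballCoord ω R y = ballCoord ω R x + R⁻¹ • (y - x) := by
    rw [← ballCoord_add, add_sub_cancel]
  have h1 : ‖R⁻¹ • (y - x)‖ ≤ 2 * (ε * ballDefect ω R x) := by
    rw [norm_inv_smul hR, div_le_iff₀ hR]
    linarith
  have h2 : ‖ballCoord ω R y‖ ≤ ‖ballCoord ω R x‖ + 2 * (ε * ballDefect ω R x) := by
    rw [hy]
    exact (norm_add_le _ _).trans (by linarith)
  have h3 : ‖ballCoord ω R x‖ ≤ ‖ballCoord ω R y‖ + 2 * (ε * ballDefect ω R x) := by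
    have h4 : ballCoord ω R x = ballCoord ω R y - R⁻¹ • (y - x) := by
      rw [hy, add_sub_cancel_right]
    rw [h4]
    exact (norm_sub_le _ _).trans (by linarith)
  have hε0 : 0 ≤ ε * ballDefect ω R x := by linarith [norm_nonneg (R⁻¹ • (y - x))]
  have hν0 : 0 ≤ ‖ballCoord ω R x‖ := norm_nonneg _
  have hμ0 : 0 ≤ ‖ballCoord ω R y‖ := norm_nonneg _
  have hdef : ballDefect ω R x = 1 - ‖ballCoord ω R x‖ ^ 2 := rfl
  have hdefy : ballDefect ω R y = 1 - ‖ballCoord ω R y‖ ^ 2 := rfl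
  set d := ballDefect ω R x
  set ν := ‖ballCoord ω R x‖
  set μ := ‖ballCoord ω R y‖
  have h5 : ν + ε * d ≤ 1 := by nlinarith
  rw [hdefy]
  constructor
  · have h6 : μ ^ 2 ≤ (ν + 2 * (ε * d)) ^ 2 := by gcongr
    nlinarith
  · rcases le_total ν μ with h | h
    · nlinarith
    · nlinarith

/-- The loss of `(1 - θ)^(n + 3)` caused by a relative variation `θ = 4 ε` of `ballDefect` is at
most a factor `2`. -/
theorem one_half_le_one_sub_pow {n : ℕ} (hn : 2 ≤ n) {ε : ℝ}
    (h : ((n : ℝ) + 1) * (n + 2) / 2 * ε ≤ 3 / 20) (hε : ε ≤ 1 / 40) :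
    1 / 2 ≤ (1 - 4 * ε) ^ (n + 3) := by
  have hn' : (2 : ℝ) ≤ n := by exact_mod_cast hn
  have h1 := one_add_mul_le_pow (a := -(4 * ε)) (by linarith) (n + 3)
  rw [← sub_eq_add_neg] at h1
  refine le_trans ?_ h1
  push_cast
  -- `(n + 3) / ((n + 1) (n + 2)) ≤ 5 / 12`
  have h2 : (12 : ℝ) * (n + 3) ≤ 5 * ((n + 1) * (n + 2)) := by nlinarith
  rcases le_or_gt ε 0 with h3 | h3
  · nlinarith
  · nlinarith [mul_le_mul_of_nonneg_right h2 h3.le]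

section Newton

variable {n s : ℕ} {ω : Cn n} {R : ℝ} [CompleteSpace (BergmanSpace ω R)]

/-- One Newton step makes the residual quadratically small; `M` bounds the norm of the
Moore–Penrose inverse after the step. Here `σ² = 1 - ν_x²` at a reference point, and `η` controls the
relative variation of this quantity. -/
theorem newtonStep_residual_le (hn : 2 ≤ n) (hR : 0 < R) {p : SystemPoint s ω R}
    (hp : p.snd ∈ ball ω R) {σ η P : ℝ} (hσ : 0 < σ) (hη : 0 < η) (hη1 : η ≤ 1)
    (hηn : 1 / 2 ≤ η ^ (n + 3)) (hP : ‖p.fst‖ ≤ P)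
    (h0 : σ ^ 2 * η ≤ ballDefect ω R p.snd)
    (h1 : σ ^ 2 * η ≤ ballDefect ω R (newtonStep p).snd) :
    (σ / √η) ^ (n + 1) * ‖evalMap (newtonStep p)‖ ≤
      (n + 1) * (n + 2) * (8 / 5 * P / (R * σ ^ 2) ^ 2 + 3 / 10 / (R * σ ^ 2)) *
        ‖newtonStep p - p‖ ^ 2 := by
  set q := newtonStep p - p with hq
  have hpq : p + q = newtonStep p := add_sub_cancel _ _
  set t := √η with ht
  have ht0 : 0 < t := Real.sqrt_pos.2 hη
  have ht2 : t ^ 2 = η := Real.sq_sqrt hη.le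
  have hP0 : 0 ≤ P := (norm_nonneg _).trans hP
  have hpqs : p.snd + q.snd = (newtonStep p).snd := by rw [← hpq]; rfl
  have h2 := norm_evalMap_taylor_le hn hR p q hp (e := σ * t) (by positivity)
    (by rwa [mul_pow, ht2]) (by rwa [mul_pow, ht2, hpqs])
  rw [hq, evalDeriv_newtonStep_sub hn hR p hp, ← hq, sub_neg_eq_add, sub_add_cancel, hpq,
    norm_inv_smul hR] at h2
  have hη2 : η⁻¹ ^ (n + 3) ≤ 2 := by
    rw [inv_pow]
    exact (inv_anti₀ (by norm_num) hηn).trans_eq (by norm_num)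
  have hη3 : η⁻¹ ^ (n + 2) ≤ 2 :=
    (pow_le_pow_right₀ ((one_le_inv₀ hη).2 hη1) (by omega)).trans hη2
  have hgv : 2 * (‖q.snd‖ * ‖q.fst‖) ≤ ‖q‖ ^ 2 := by
    rw [WithLp.prod_norm_sq_eq_of_L2]
    linarith [two_mul_le_add_sq ‖q.fst‖ ‖q.snd‖]
  have hv : ‖q.snd‖ ^ 2 ≤ ‖q‖ ^ 2 := by
    gcongr
    exact SystemPoint.norm_snd_le q
  have hC : (0 : ℝ) ≤ (n + 1) * (n + 2) := by positivity
  -- the powers of `σ` cancel, and those of `η` are bounded by `2`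
  have e1 : (σ / t) ^ (n + 1) * (σ * t)⁻¹ ^ (n + 5) = η⁻¹ ^ (n + 3) / (σ ^ 2) ^ 2 := by
    rw [← ht2, div_pow, inv_pow, inv_pow, mul_pow]
    field_simp
    ring
  have e2 : (σ / t) ^ (n + 1) * (σ * t)⁻¹ ^ (n + 3) = η⁻¹ ^ (n + 2) / σ ^ 2 := by
    rw [← ht2, div_pow, inv_pow, inv_pow, mul_pow]
    field_simp
    ring
  calc (σ / t) ^ (n + 1) * ‖evalMap (newtonStep p)‖
      ≤ (σ / t) ^ (n + 1) *
        (4 / 5 * ((n + 1) * (n + 2)) * (‖q.snd‖ / R) ^ 2 * (σ * t)⁻¹ ^ (n + 5) * ‖p.fst‖ +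
          3 / 10 * ((n + 1) * (n + 2)) * (‖q.snd‖ / R) * (σ * t)⁻¹ ^ (n + 3) * ‖q.fst‖) := by
        gcongr
    _ = (n + 1) * (n + 2) *
        (4 / 5 * (‖q.snd‖ / R) ^ 2 * ((σ / t) ^ (n + 1) * (σ * t)⁻¹ ^ (n + 5)) * ‖p.fst‖ +
          3 / 10 / R * ((σ / t) ^ (n + 1) * (σ * t)⁻¹ ^ (n + 3)) * (‖q.snd‖ * ‖q.fst‖)) := by
        ring
    _ ≤ (n + 1) * (n + 2) *
        (4 / 5 * (‖q.snd‖ / R) ^ 2 * (2 / (σ ^ 2) ^ 2) * P +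
          3 / 10 / R * (2 / σ ^ 2) * (‖q.snd‖ * ‖q.fst‖)) := by
        rw [e1, e2]
        gcongr
    _ = (n + 1) * (n + 2) * (8 / 5 * P / (R * σ ^ 2) ^ 2 * ‖q.snd‖ ^ 2 +
          3 / 10 / (R * σ ^ 2) * (2 * (‖q.snd‖ * ‖q.fst‖))) := by
        field_simp
        ring
    _ ≤ (n + 1) * (n + 2) * (8 / 5 * P / (R * σ ^ 2) ^ 2 * ‖q‖ ^ 2 +
          3 / 10 / (R * σ ^ 2) * ‖q‖ ^ 2) := by gcongr
    _ = _ := by ring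

/-- Convergence of the Newton sequence, with the hypothesis in terms of the radius
`b = (1 - ν_x²)^((n + 1) / 2) ‖f(x)‖` and of `δ = 1 - ν_x²`. -/
theorem newton_converges (hn : 2 ≤ n) (hR : 0 < R) (f : BergmanSystem s ω R) {x : Cn n}
    (hx : x ∈ ball ω R)
    (h : ((n : ℝ) + 1) * (n + 2) / 2 * (‖f‖ / (R * ballDefect ω R x) + 1) *
      (√(ballDefect ω R x) ^ (n + 1) * ‖f.value x‖ / (R * ballDefect ω R x)) ≤ 3 / 20) :
    NewtonWellDefined f x ∧
      ∃ (g : BergmanSystem s ω R) (y : Cn n), y ∈ ball ω R ∧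
        ConvergesQuadratically (newtonSeq f x) (WithLp.toLp 2 (g, y)) ∧
        g.value y = 0 ∧
        √(‖f - g‖ ^ 2 + ‖x - y‖ ^ 2) ≤ c₀ * (√(ballDefect ω R x) ^ (n + 1) * ‖f.value x‖) := by
  have hd := ballDefect_pos hR hx
  have hn' : (2 : ℝ) ≤ n := by exact_mod_cast hn
  set d := ballDefect ω R x with hdd
  set b := √d ^ (n + 1) * ‖f.value x‖ with hb
  have hb0 : 0 ≤ b := by positivity
  set ε := b / (R * d) with hε
  set φ := ‖f‖ / (R * d) with hφ
  have hε0 : 0 ≤ ε := by positivity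
  have hφ0 : 0 ≤ φ := by positivity
  have hbε : b = ε * (R * d) := by
    rw [hε]
    field_simp
  have hC : (6 : ℝ) ≤ (n + 1) * (n + 2) / 2 := by nlinarith
  have hCε : ((n : ℝ) + 1) * (n + 2) / 2 * ε ≤ 3 / 20 := by
    have : 0 ≤ ((n : ℝ) + 1) * (n + 2) / 2 * φ * ε := by positivity
    linarith
  have hε40 : ε ≤ 1 / 40 := by nlinarith
  set p : SystemPoint s ω R := WithLp.toLp 2 (f, x) with hp
  have hc2 : c₀ * b ≤ 2 * b := mul_le_mul_of_nonneg_right c₀_le_two hb0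
  have hnear : ∀ q : SystemPoint s ω R, ‖q - p‖ ≤ c₀ * b →
      d * (1 - 4 * ε) ≤ ballDefect ω R q.snd ∧ ballDefect ω R q.snd ≤ d * (1 + 4 * ε) :=
    fun q hq => by
      refine ballDefect_near hR hx hε40 ?_
      rw [← hdd, ← hbε]
      exact ((SystemPoint.norm_snd_le (q - p)).trans hq).trans hc2
  have hη : 0 < 1 - 4 * ε := by linarith
  have hball : ∀ q : SystemPoint s ω R, ‖q - p‖ ≤ c₀ * b → q.snd ∈ ball ω R := fun q hq =>
    (ballDefect_pos_iff hR).1 ((mul_pos hd hη).trans_le (hnear q hq).1)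
  set a := ((n : ℝ) + 1) * (n + 2) *
    (8 / 5 * (‖f‖ + 2 * b) / (R * d) ^ 2 + 3 / 10 / (R * d)) with ha
  have hσ2 : √d ^ 2 = d := Real.sq_sqrt hd.le
  have hresidual : ∀ q : SystemPoint s ω R, ‖q - p‖ ≤ c₀ * b → ‖newtonStep q - p‖ ≤ c₀ * b →
      (√d / √(1 - 4 * ε)) ^ (n + 1) * ‖evalMap (newtonStep q)‖ ≤ a * ‖newtonStep q - q‖ ^ 2 :=
    fun q hq hq' => by
      have hP : ‖q.fst‖ ≤ ‖f‖ + 2 * b := by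
        have h1 : ‖q.fst - f‖ ≤ 2 * b :=
          ((SystemPoint.norm_fst_le (q - p)).trans hq).trans hc2
        have h2 := norm_le_insert' q.fst f
        linarith
      have h3 := newtonStep_residual_le hn hR (hball q hq) (Real.sqrt_pos.2 hd) hη (by linarith)
        (one_half_le_one_sub_pow hn hCε hε40) hP (by rw [hσ2]; exact (hnear q hq).1)
        (by rw [hσ2]; exact (hnear _ hq').1)
      rwa [hσ2] at h3
  have hstep : ∀ q : SystemPoint s ω R, ‖q - p‖ ≤ c₀ * b → ‖newtonStep q - p‖ ≤ c₀ * b →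
      ‖newtonStep (newtonStep q) - newtonStep q‖ ≤ a * ‖newtonStep q - q‖ ^ 2 :=
    fun q hq hq' => by
      refine (norm_newtonStep_sub_le hn hR _ (hball _ hq')).trans
        (le_trans ?_ (hresidual q hq hq'))
      gcongr
      rw [← Real.sqrt_div hd.le]
      refine Real.sqrt_le_sqrt ((hnear _ hq').2.trans ?_)
      rw [le_div_iff₀ hη]
      nlinarith [mul_nonneg hd.le (sq_nonneg ε)]
  have ha0 : 0 ≤ a := by positivity
  have hab : a * b ≤ 1 / 2 := by
    have h1 : a * b = 2 * (((n : ℝ) + 1) * (n + 2) / 2 * ε) * (8 / 5 * (φ + 2 * ε) + 3 / 10) := by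
      rw [ha, hφ, hbε]
      field_simp
    have h2 : 8 / 5 * (φ + 2 * ε) + 3 / 10 ≤ 8 / 5 * (φ + 1) := by linarith
    calc a * b ≤ 2 * (((n : ℝ) + 1) * (n + 2) / 2 * ε) * (8 / 5 * (φ + 1)) := by
          rw [h1]
          gcongr
      _ ≤ 1 / 2 := by linarith
  have hfirst : ‖newtonStep p - p‖ ≤ b := norm_newtonStep_sub_le hn hR p hx
  obtain ⟨hdist, l, hconv, hl⟩ := convergesQuadratically_iterate ha0 hb0 hab hfirst hstep
  have hlball : l.snd ∈ ball ω R := hball l (by rwa [norm_sub_rev])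
  have hmem : ∀ k, (newtonSeq f x k).snd ∈ ball ω R := fun k => hball _ (hdist k)
  refine ⟨⟨hmem, fun k => (hasFDerivAt_evalMap hn hR _ (hmem k)).differentiableAt, fun k =>
    (isMoorePenroseInverse_moorePenrose (surjective_fderiv_evalMap hn hR _ (hmem k))).1⟩,
    l.fst, l.snd, hlball, hconv, ?_, ?_⟩
  · -- the residuals tend to `0`, being quadratically small in the steps
    have hsucc : ∀ k, newtonSeq f x (k + 1) = newtonStep (newtonSeq f x k) := fun k =>
      Function.iterate_succ_apply' newtonStep k p
    have h1 : Tendsto (newtonSeq f x) atTop (𝓝 l) := hconv.1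
    have h1' : Tendsto (fun k => newtonSeq f x (k + 1)) atTop (𝓝 l) :=
      h1.comp (tendsto_add_atTop_nat 1)
    have h2 : Tendsto (fun k => evalMap (newtonSeq f x (k + 1))) atTop (𝓝 (evalMap l)) :=
      (hasFDerivAt_evalMap hn hR l hlball).continuousAt.tendsto.comp h1'
    set M := (√d / √(1 - 4 * ε)) ^ (n + 1) with hM
    have hM0 : 0 < M := pow_pos (div_pos (Real.sqrt_pos.2 hd) (Real.sqrt_pos.2 hη)) _
    have h3 : Tendsto (fun k => M⁻¹ * (a * ‖newtonSeq f x (k + 1) - newtonSeq f x k‖ ^ 2)) atTop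
        (𝓝 0) := by
      have h4 := (((h1'.sub h1).norm.pow 2).const_mul a).const_mul M⁻¹
      simpa using h4
    have h5 : Tendsto (fun k => evalMap (newtonSeq f x (k + 1))) atTop (𝓝 0) := by
      refine squeeze_zero_norm (fun k => ?_) h3
      rw [inv_mul_eq_div, le_div_iff₀' hM0, hsucc]
      refine hresidual _ (hdist k) ?_
      rw [← hsucc]
      exact hdist (k + 1)
    exact tendsto_nhds_unique h2 h5
  · have h6 : √(‖f - l.fst‖ ^ 2 + ‖x - l.snd‖ ^ 2) = ‖p - l‖ := by
      rw [WithLp.prod_norm_eq_of_L2]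
      rfl
    rw [h6]
    exact hl

end Newton

/-! ### Powers of the distance to the boundary -/

theorem ballDefect_eq_nu {n : ℕ} {ω : Cn n} {R : ℝ} (hR : 0 < R) (x : Cn n) :
    ballDefect ω R x = 1 - nu ω R x ^ 2 := by
  rw [ballDefect, norm_ballCoord_eq_nu ω hR]

theorem rpow_half_add_one (n : ℕ) {d : ℝ} (hd : 0 ≤ d) :
    d ^ (((n : ℝ) + 1) / 2) = √d ^ (n + 1) := by
  rw [Real.sqrt_eq_rpow, ← Real.rpow_natCast, ← Real.rpow_mul hd]
  congr 1
  push_cast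
  ring

theorem rpow_half_sub_one (n : ℕ) {d : ℝ} (hd : 0 < d) :
    d ^ (((n : ℝ) - 1) / 2) = √d ^ (n + 1) / d := by
  rw [← rpow_half_add_one n hd.le, ← Real.rpow_sub_one hd.ne']
  congr 1
  ring

end

theorem mainTheorem6 {n s : ℕ} (hn : 2 ≤ n) (ω : Cn n) (R : ℝ) :
    (∀ (f : BergmanSystem s ω R) (x : Cn n), x ∈ Metric.ball ω R →
      c₀ * (1 - nu ω R x ^ 2) ^ (((n : ℝ) + 1) / 2) * (‖f.value x‖ / R) + nu ω R x < 1 →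
      ((n : ℝ) + 1) * ((n : ℝ) + 2) / 2 * (1 - nu ω R x ^ 2) ^ (((n : ℝ) - 1) / 2) *
        (‖f‖ / R * (1 / (1 - nu ω R x ^ 2)) + 1) * (‖f.value x‖ / R) ≤ α₀ →
      NewtonWellDefined f x ∧
      ∃ (g : BergmanSystem s ω R) (y : Cn n), y ∈ Metric.ball ω R ∧
        ConvergesQuadratically (newtonSeq f x) (WithLp.toLp 2 (g, y)) ∧
        g.value y = 0 ∧
        Real.sqrt (‖f - g‖ ^ 2 + ‖x - y‖ ^ 2) ≤
          c₀ * (1 - nu ω R x ^ 2) ^ (((n : ℝ) + 1) / 2) * ‖f.value x‖) ∧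
    (0 < R → ∀ f : BergmanSystem s ω R,
      c₀ * (‖f.value ω‖ / R) < 1 →
      ((n : ℝ) + 1) * ((n : ℝ) + 2) / 2 * (‖f‖ / R + 1) * (‖f.value ω‖ / R) ≤ α₀ →
      NewtonWellDefined f ω ∧
      ∃ (g : BergmanSystem s ω R) (y : Cn n), y ∈ Metric.ball ω R ∧
        ConvergesQuadratically (newtonSeq f ω) (WithLp.toLp 2 (g, y)) ∧
        g.value y = 0 ∧
        Real.sqrt (‖f - g‖ ^ 2 + ‖ω - y‖ ^ 2) ≤ c₀ * ‖f.value ω‖) := by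
  have main : ∀ (f : BergmanSystem s ω R) (x : Cn n), x ∈ Metric.ball ω R →
      ((n : ℝ) + 1) * ((n : ℝ) + 2) / 2 * (1 - nu ω R x ^ 2) ^ (((n : ℝ) - 1) / 2) *
        (‖f‖ / R * (1 / (1 - nu ω R x ^ 2)) + 1) * (‖f.value x‖ / R) ≤ α₀ →
      NewtonWellDefined f x ∧
      ∃ (g : BergmanSystem s ω R) (y : Cn n), y ∈ Metric.ball ω R ∧
        ConvergesQuadratically (newtonSeq f x) (WithLp.toLp 2 (g, y)) ∧
        g.value y = 0 ∧
        Real.sqrt (‖f - g‖ ^ 2 + ‖x - y‖ ^ 2) ≤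
          c₀ * (1 - nu ω R x ^ 2) ^ (((n : ℝ) + 1) / 2) * ‖f.value x‖ := by
    intro f x hx h
    have hR : 0 < R := Metric.pos_of_mem_ball hx
    have hd := ballDefect_pos hR hx
    have := BergmanSpace.completeSpace (n := n) (ω := ω) (by omega) hR
    rw [← ballDefect_eq_nu hR x, rpow_half_sub_one n hd] at h
    rw [← ballDefect_eq_nu hR x, rpow_half_add_one n hd.le, mul_assoc]
    refine newton_converges hn hR f hx (le_trans (le_of_eq ?_) (h.trans α₀_le))
    field_simp
  refine ⟨fun f x hx _ h => main f x hx h, fun hR f _ h => ?_⟩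
  have hnu : nu ω R ω = 0 := by simp [nu]
  have h1 := main f ω (Metric.mem_ball_self hR)
  simp only [hnu, ne_eq, OfNat.ofNat_ne_zero, not_false_eq_true, zero_pow, sub_zero,
    Real.one_rpow, mul_one, div_one] at h1
  exact h1 h
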